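/- Consider the deterministic synchronous CONGEST model on a finite, simple, undirected, unweighted bipartite graph $G=(A\cup B,E)$ with $n=|A|+|B|$ vertices and $|A|\le |B|$ ($G$ need not be connected). The vertices have unique identifiers of $O(\log n)$ bits. Initially each vertex knows only its identifier, its incident edges (as locally labelled ports), whether it lies in $A$ or in $B$, and estimates of $n$ and of $|A|$ that are correct up to a constant factor. In each round every vertex may send a message of $O(\log n)$ bits over each of its incident edges, and local computation is free. For every even $k\ge 4$ there is a deterministic algorithm in this model that, on every such graph, constructs a $(2k-1)$-spanner $H$ of $G$, i.e. a subgraph $H\subseteq G$ with $\mathrm{dist}(u,v,H)\le (2k-1)\,\mathrm{dist}(u,v,G)$ for all vertices $u,v$, such that $$|E(H)| = O\bigl(k\,|A|^{1+2/k}+|B|\bigr),$$ within $O\bigl(|A|^{1-2/k}\bigr)$ rounds; when the algorithm has halted at all vertices, each vertex knows which of its incident edges belong to $H$. The constants in the $O(\cdot)$ bounds for messages, edges and rounds are independent of $k$ and of $G$; they depend only on the constant in the bound on the identifier length and on the approximation constant of the estimates. -/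

import Mathlib

/-! # Deterministic CONGEST algorithms on bipartite networks, and spanners -/

namespace Congest

/-- What a vertex knows before the first round: its own identifier, its side of the bipartition
(`true` for `A`, `false` for `B`), the labels of its ports (one port per incident edge), and
estimates of the number `n` of vertices and of `|A|`. Nothing about its neighbours is known. -/
structure LocalInput where
  ident : ℕ
  inA : Bool
  ports : Finset ℕ
  nEst : ℕ
  aEst : ℕ

/-- A deterministic synchronous message-passing algorithm; local computation is free.
A message is a natural number, read as the bit string of its binary expansion; the message `0`
(no bits) is silence. -/
structure Algorithm where
  /-- local states -/
  State : Type
  /-- the initial state, a function of the local input only -/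
  init : LocalInput → State
  /-- `send s p` is the message that a vertex in state `s` sends through its port `p` -/
  send : State → ℕ → ℕ
  /-- the new state, from the old one and the messages received through the ports -/
  step : State → (ℕ → ℕ) → State
  /-- `none` while the vertex is running; `some S` once it has halted, where `S` is the set of
  (ports of) incident edges that it has selected -/
  output : State → Option (Finset ℕ)

/-- A network with a distinguished vertex set `A`: a graph with unique identifiers, where `port v u`
is the label that `v` uses for the edge `vu`. The labels are arbitrary, except that
the edges at one vertex get distinct labels. -/
structure Network (V : Type*) where
  graph : SimpleGraph V
  A : Finset V
  ident : V → ℕ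
  ident_injective : Function.Injective ident
  port : V → V → ℕ
  port_injOn : ∀ v, Set.InjOn (port v) (graph.neighborSet v)
  nEst : ℕ
  aEst : ℕ

open Classical in
/-- The local input of the vertex `v`. -/
noncomputable def Network.localInput {V : Type*} [Fintype V] (N : Network V) (v : V) :
    LocalInput where
  ident := N.ident v
  inA := decide (v ∈ N.A)
  ports := (N.graph.neighborFinset v).image (N.port v)
  nEst := N.nEst
  aEst := N.aEst

/-- The message sent by `u` along the edge `uv` in the configuration `σ`; halted vertices
are silent. -/
def sent {V : Type*} (N : Network V) (P : Algorithm) (σ : V → P.State) (u v : V) : ℕ :=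
  if (P.output (σ u)).isSome then 0 else P.send (σ u) (N.port u v)

open Classical in
/-- The message received by `v` through port `p` in the configuration `σ`
(`0` if `v` has no such port). -/
noncomputable def inbox {V : Type*} (N : Network V) (P : Algorithm) (σ : V → P.State)
    (v : V) (p : ℕ) : ℕ :=
  if h : ∃ u, N.graph.Adj v u ∧ N.port v u = p then sent N P σ h.choose v else 0

/-- One synchronous round; halted vertices keep their state. -/
noncomputable def next {V : Type*} (N : Network V) (P : Algorithm) (σ : V → P.State) :
    V → P.State :=
  fun v => if (P.output (σ v)).isSome then σ v else P.step (σ v) (inbox N P σ v)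

/-- The configuration after `t` rounds. -/
noncomputable def run {V : Type*} [Fintype V] (N : Network V) (P : Algorithm) :
    ℕ → V → P.State
  | 0 => fun v => P.init (N.localInput v)
  | t + 1 => next N P (run N P t)

/-- In every round, every message along every edge has at most `b` bits. -/
def RespectsBandwidth {V : Type*} [Fintype V] (N : Network V) (P : Algorithm) (b : ℕ) : Prop :=
  ∀ t u v, N.graph.Adj u v → (sent N P (run N P t) u v).size ≤ b

/-- After `T` rounds all vertices have halted, and both endpoints of every edge know
whether the edge belongs to the subgraph `H`. -/
def ConstructsWithin {V : Type*} [Fintype V] (N : Network V) (P : Algorithm)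
    (H : SimpleGraph V) (T : ℕ) : Prop :=
  ∀ v, ∃ S, P.output (run N P T v) = some S ∧
    ∀ u, N.graph.Adj v u → (N.port v u ∈ S ↔ H.Adj v u)

/-- `H` is an `r`-spanner of `G`: a subgraph with `dist(u,v,H) ≤ r * dist(u,v,G)` for all
vertices `u`, `v` (the distance is `⊤` between different components). -/
def IsSpanner {V : Type*} (G H : SimpleGraph V) (r : ℕ) : Prop :=
  H ≤ G ∧ ∀ u v, H.edist u v ≤ (r : ℕ∞) * G.edist u v

end Congest

/-!
The idea is region growing with clusters whose radius and size grow from level to level, as in the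
construction of `(2 * κ - 1)`-spanners with `O(κ * |A| ^ (1 + 1 / κ))` edges, applied to
`κ = k / 2` and to the relation "has a common neighbour" on `A`. One step of this relation costs two
edges of the graph, and the odd edge that is left over is paid for by `O(1)` edges for each vertex
of `B`. Let `M ≥ |A|` be the bound that the vertices know, and let `q` be the least number with
`M < q ^ κ`.

*Upper levels.* At level `i ≥ 1` there are disjoint sets of active vertices of `A`, each
at distance at most `2 * i` in the spanner from its centre; they have at least `q ^ i` members on
average, so there are at most `|A| / q ^ i` of them. The centres take turns. A centre whose turn it
is finds all vertices that are still active and lie within two steps from the vertices at distance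
at most `2 * i` in the spanner, and the spanner receives the last two edges of the paths to them. If
`q ^ (i + 1)` or more have been found, then they are absorbed by a cluster of the next level; their
edges are charged to them. Otherwise the edges are few. A vertex that is not absorbed has been found
by the centres of all clusters that contain a vertex with which it has a common neighbour, so these
pairs are at distance at most `4 * i + 2` in the spanner. At level `κ` there is no cluster
left (`exec_level`, `Clustered.not_act`).

*Turns.* The candidates flood their identifiers to a distance that is twice the radius of
the search, and those that hear of no larger one search at the same time, without
interference; the largest candidate is always among them, so that as many iterations as there are
clusters suffice. The counts are summed up along the search trees (`exec_explore`). The number of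
rounds is `O((i + 1) * M / q ^ i)` at level `i`, hence `O(M / q)` in total (`length_program_le`).

*Bottom level.* There are too many vertices in `A` for all of them to take turns. Every `b` in `B`
chooses one neighbour as its head, and the load of `x` is the number of active vertices
that have a neighbour with head `x`. Only vertices with load at least `q` become candidates, and each
winner absorbs at least `q` vertices; so `M / q + 1` iterations lead to loads less than `q`, and then
every active vertex can afford one edge for each head among the heads of its neighbours. This spans
the edges at active vertices with stretch three. A vertex of `B` with an absorbed neighbour selects
an edge to such a neighbour, which leaves only pairs of absorbed vertices with a common neighbour for
the upper levels (`exec_bottomLevel`).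

The algorithm is a list of instructions, one for each round, which all vertices execute
in lockstep (`machine`). Its length depends only on `k` and on the estimate of `|A|`, so all vertices
halt at the same time. `Exec` is the corresponding big-step semantics, which includes the bound on
the messages.
-/

namespace Congest

/-! ### Short walks -/

/-- `Within G r u v`: there is a walk of at most `r` edges from `u` to `v` in `G`. -/
def Within {V : Type*} (G : SimpleGraph V) : ℕ → V → V → Prop
  | 0, u, v => u = v
  | r + 1, u, v => Within G r u v ∨ ∃ w, Within G r u w ∧ G.Adj w v

namespace Within

variable {V : Type*} {G H : SimpleGraph V}

theorem refl (r : ℕ) (u : V) : Within G r u u := by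
  induction r with
  | zero => rfl
  | succ r ih => exact Or.inl ih

theorem mono_right {r s : ℕ} (h : r ≤ s) {u v : V} (huv : Within G r u v) : Within G s u v := by
  induction h with
  | refl => exact huv
  | step _ ih => exact Or.inl ih

theorem mono (h : G ≤ H) {r : ℕ} {u v : V} (huv : Within G r u v) : Within H r u v := by
  induction r generalizing v with
  | zero => exact huv
  | succ r ih =>
    rcases huv with huv | ⟨w, hw, ha⟩
    · exact Or.inl (ih huv)
    · exact Or.inr ⟨w, ih hw, h ha⟩

theorem of_adj {u v : V} (h : G.Adj u v) : Within G 1 u v := Or.inr ⟨u, rfl, h⟩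

theorem trans {r s : ℕ} {u v w : V} (huv : Within G r u v) (hvw : Within G s v w) :
    Within G (r + s) u w := by
  induction s generalizing w with
  | zero => cases hvw; exact huv
  | succ s ih =>
    rcases hvw with hvw | ⟨x, hx, ha⟩
    · exact Or.inl (ih hvw)
    · exact Or.inr ⟨x, ih hx, ha⟩

theorem symm {r : ℕ} {u v : V} (huv : Within G r u v) : Within G r v u := by
  induction r generalizing v with
  | zero => exact Eq.symm huv
  | succ r ih =>
    rcases huv with huv | ⟨w, hw, ha⟩
    · exact Or.inl (ih huv)
    · have := (of_adj ha.symm).trans (ih hw)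
      rwa [add_comm] at this

theorem edist_le {r : ℕ} {u v : V} (huv : Within G r u v) : G.edist u v ≤ r := by
  suffices h : ∃ p : G.Walk u v, p.length ≤ r by
    obtain ⟨p, hp⟩ := h
    exact (SimpleGraph.Walk.edist_le p).trans (by exact_mod_cast hp)
  induction r generalizing v with
  | zero => cases huv; exact ⟨.nil, le_rfl⟩
  | succ r ih =>
    rcases huv with huv | ⟨w, hw, ha⟩
    · obtain ⟨p, hp⟩ := ih huv
      exact ⟨p, hp.trans r.le_succ⟩
    · obtain ⟨p, hp⟩ := ih hw
      exact ⟨p.concat ha, by simpa using hp⟩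

end Within

/-! ### Programs and their execution -/

/-- The local memory of a vertex. Ports are used as names of incident edges. -/
structure Register where
  /-- the selected ports -/
  sel : Finset ℕ
  /-- for a vertex of `A`: one port for each head that occurs among its neighbours -/
  rep : Finset ℕ
  /-- for a vertex of `B`: one more than the identifier of its head -/
  head : ℕ
  /-- for a vertex of `B`: the port leading to its head; at the end of the bottom level, the port
  leading to a neighbour that has been absorbed, if there is one -/
  up : ℕ
  /-- the vertex takes part in the current level and has not been absorbed by a new cluster -/
  act : Prop
  /-- the vertex has been absorbed by a new cluster in the current level -/
  taken : Prop
  /-- the vertex is the centre of a cluster that is still to be processed -/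
  cand : Prop
  /-- the vertex is the centre of a new cluster -/
  next : Prop
  /-- the largest candidate seen so far -/
  val : ℕ
  /-- one more than the identifier of the root of the search tree; `0` outside of all trees -/
  root : ℕ
  /-- the depth in the search tree -/
  dep : ℕ
  /-- the port leading to the parent in the search tree -/
  par : ℕ
  /-- an accumulator -/
  cnt : ℕ
  /-- the root of the search tree has decided to build a new cluster -/
  dec : Prop

/-- One round of a program: the messages that a vertex sends through its ports, and its new memory,
given the messages received. The local input is available in every round. -/
structure Instr where
  send : LocalInput → Register → ℕ → ℕ
  recv : LocalInput → Register → (ℕ → ℕ) → Register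

/-- The algorithm that executes a list of instructions, one per round, and halts at its end.
Messages above the bound `cap` are suppressed, so that the bandwidth is respected by construction;
`Exec` ensures that this never happens. -/
def machine (cap : LocalInput → ℕ) (init : LocalInput → Register)
    (prog : LocalInput → List Instr) : Algorithm where
  State := LocalInput × Register × List Instr
  init x := (x, init x, prog x)
  send s p := match s.2.2 with
    | [] => 0
    | I :: _ => if I.send s.1 s.2.1 p ≤ cap s.1 then I.send s.1 s.2.1 p else 0
  step s m := match s.2.2 with
    | [] => s
    | I :: l => (s.1, I.recv s.1 s.2.1 m, l)
  output s := match s.2.2 with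
    | [] => some s.2.1.sel
    | _ :: _ => none

/-- The state of the machine at a vertex with input `x`, memory `s` and remaining program `l`. -/
def machineState {cap : LocalInput → ℕ} {init : LocalInput → Register}
    {prog : LocalInput → List Instr} (x : LocalInput) (s : Register) (l : List Instr) :
    (machine cap init prog).State := (x, s, l)

section Exec

theorem port_inj {V : Type*} (N : Network V) {v u w : V} (hu : N.graph.Adj v u)
    (hw : N.graph.Adj v w) (h : N.port v u = N.port v w) : u = w :=
  N.port_injOn v hu hw h

variable {V : Type*} [Fintype V] (N : Network V)

theorem mem_ports {v : V} {p : ℕ} :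
    p ∈ (N.localInput v).ports ↔ ∃ u, N.graph.Adj v u ∧ N.port v u = p := by
  simp [Network.localInput]

theorem port_mem {v u : V} (h : N.graph.Adj v u) : N.port v u ∈ (N.localInput v).ports :=
  (mem_ports N).2 ⟨u, h, rfl⟩

open scoped Classical in
theorem sum_ports (v : V) (f : ℕ → ℕ) :
    ∑ p ∈ (N.localInput v).ports, f p = ∑ u, if N.graph.Adj v u then f (N.port v u) else 0 := by
  rw [← Finset.sum_filter]
  have : (N.localInput v).ports
      = (Finset.univ.filter fun u => N.graph.Adj v u).image (N.port v) := by
    ext p; simp [mem_ports]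
  rw [this, Finset.sum_image]
  intro a ha b hb h
  exact port_inj N (by simpa using ha) (by simpa using hb) h

open scoped Classical in
/-- The messages that `v` receives when all vertices execute `I` in the configuration `σ`. -/
noncomputable def received (I : Instr) (σ : V → Register) (v : V) (p : ℕ) : ℕ :=
  if h : ∃ u, N.graph.Adj v u ∧ N.port v u = p then
    I.send (N.localInput h.choose) (σ h.choose) (N.port h.choose v) else 0

theorem received_port (I : Instr) (σ : V → Register) {v u : V} (h : N.graph.Adj v u) :
    received N I σ v (N.port v u) = I.send (N.localInput u) (σ u) (N.port u v) := by
  have hex : ∃ w, N.graph.Adj v w ∧ N.port v w = N.port v u := ⟨u, h, rfl⟩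
  have := port_inj N hex.choose_spec.1 h hex.choose_spec.2
  rw [received, dif_pos hex, this]

/-- The configuration after all vertices have executed `I`. -/
noncomputable def round (I : Instr) (σ : V → Register) (v : V) : Register :=
  I.recv (N.localInput v) (σ v) (received N I σ v)

/-- The list `l` of instructions leads from the configuration `σ` to `τ`, and no message exceeds
`K` on the way. -/
def Exec (K : ℕ) : List Instr → (V → Register) → (V → Register) → Prop
  | [], σ, τ => σ = τ
  | I :: l, σ, τ =>
    (∀ u v, N.graph.Adj u v → I.send (N.localInput u) (σ u) (N.port u v) ≤ K) ∧
      Exec K l (round N I σ) τ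

variable {N} {K : ℕ}

theorem Exec.append {l₁ l₂ : List Instr} {σ τ υ : V → Register} (h₁ : Exec N K l₁ σ τ)
    (h₂ : Exec N K l₂ τ υ) : Exec N K (l₁ ++ l₂) σ υ := by
  induction l₁ generalizing σ with
  | nil => cases h₁; exact h₂
  | cons I l ih => exact ⟨h₁.1, ih h₁.2⟩

theorem Exec.single {I : Instr} {σ : V → Register}
    (h : ∀ u v, N.graph.Adj u v → I.send (N.localInput u) (σ u) (N.port u v) ≤ K) :
    Exec N K [I] σ (round N I σ) := ⟨h, rfl⟩

/-- A loop: an invariant is kept by every pass, hence by the whole loop. -/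
theorem Exec.flatten {ls : ℕ → List Instr} (Inv : ℕ → (V → Register) → Prop) (m n : ℕ)
    (step : ∀ j σ, m ≤ j → j < m + n → Inv j σ → ∃ τ, Exec N K (ls j) σ τ ∧ Inv (j + 1) τ)
    {σ : V → Register} (h : Inv m σ) :
    ∃ τ, Exec N K ((List.range' m n).map ls).flatten σ τ ∧ Inv (m + n) τ := by
  induction n generalizing m σ with
  | zero => exact ⟨σ, rfl, h⟩
  | succ n ih =>
    obtain ⟨τ, h₁, h₂⟩ := step m σ le_rfl (by omega) h
    obtain ⟨υ, h₃, h₄⟩ := ih (m + 1) (fun j σ h₁ h₂ => step j σ (by omega) (by omega)) h₂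
    refine ⟨υ, ?_, by rwa [show m + (n + 1) = m + 1 + n by omega]⟩
    rw [List.range'_succ, List.map_cons, List.flatten_cons]
    exact h₁.append h₃

theorem run_machine_aux {cap : LocalInput → ℕ} {init : LocalInput → Register}
    {prog : LocalInput → List Instr} (hcap : ∀ v, cap (N.localInput v) = K) {l : List Instr}
    {σ τ : V → Register} (h : Exec N K l σ τ) :
    (Congest.next N (machine cap init prog))^[l.length] (fun v => machineState (N.localInput v) (σ v) l)
      = fun v => machineState (N.localInput v) (τ v) [] := by
  induction l generalizing σ with
  | nil => cases h; rfl
  | cons I l ih =>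
    rw [List.length_cons, Function.iterate_succ_apply, ← ih h.2]
    congr 1
    funext v
    have : inbox N (machine cap init prog) (fun v => machineState (N.localInput v) (σ v) (I :: l)) v
        = received N I σ v := by
      funext p
      unfold inbox received
      split
      · next hex =>
        have := h.1 _ _ hex.choose_spec.1.symm
        rw [sent, if_neg (by simp [machine, machineState])]
        exact if_pos (this.trans_eq (hcap _).symm)
      · rfl
    rw [Congest.next, this]
    exact if_neg (by simp [machine, machineState])

/-- If the program leads from the initial configuration to `τ`, then so does the
algorithm that executes it. -/
theorem run_machine {cap : LocalInput → ℕ} {init : LocalInput → Register}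
    {prog : LocalInput → List Instr} (hcap : ∀ v, cap (N.localInput v) = K) {l : List Instr}
    (hl : ∀ v, prog (N.localInput v) = l)
    {τ : V → Register} (h : Exec N K l (fun v => init (N.localInput v)) τ) (v : V) :
    run N (machine cap init prog) l.length v
      = machineState (N.localInput v) (τ v) [] := by
  have hrun : ∀ t, run N (machine cap init prog) t
      = (Congest.next N (machine cap init prog))^[t] (run N (machine cap init prog) 0) := by
    intro t
    induction t with
    | zero => rfl
    | succ t ih => rw [Function.iterate_succ_apply', ← ih]; rfl
  have h0 : run N (machine cap init prog) 0
      = fun v => machineState (N.localInput v) (init (N.localInput v)) l := by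
    funext v
    rw [← hl v]
    rfl
  rw [hrun, h0, run_machine_aux hcap h]

theorem sent_machine_le {cap : LocalInput → ℕ} {init : LocalInput → Register}
    {prog : LocalInput → List Instr} (hcap : ∀ v, cap (N.localInput v) = K) (t : ℕ) (u v : V) :
    sent N (machine cap init prog) (run N (machine cap init prog) t) u v ≤ K := by
  have hfst : ∀ t u, (run N (machine cap init prog) t u).1 = N.localInput u := by
    intro t
    induction t with
    | zero => intro u; rfl
    | succ t ih =>
      intro u
      rw [run, Congest.next]
      split
      · exact ih u
      · rw [← ih u]
        simp only [machine]
        split <;> rfl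
  unfold sent
  split
  · exact Nat.zero_le _
  · simp only [machine]
    split
    · exact Nat.zero_le _
    · split
      · next h => rw [← hcap u, ← hfst t u]; exact h
      · exact Nat.zero_le _

end Exec

/-! ### Flooding and searching -/

section Search

open scoped Classical

/-- A round of local computation. -/
def silent (f : LocalInput → Register → Register) : Instr where
  send _ _ _ := 0
  recv x s _ := f x s

/-- One round of flooding the maximum of `val`. -/
def flood : Instr where
  send _ s _ := s.val
  recv x s m := { s with val := max s.val (x.ports.sup m) }

/-- One round of the search: trees grow by the vertices of depth `t`, along
selected edges only if `onlySel`. -/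
noncomputable def search (onlySel : Bool) (t : ℕ) : Instr where
  send _ s p := if onlySel = true → p ∈ s.sel then s.root else 0
  recv x s m :=
    if h : s.root = 0 ∧ ∃ p ∈ x.ports, m p ≠ 0 then
      { s with root := m h.2.choose, dep := t, par := h.2.choose }
    else s

variable {V : Type*} [Fintype V] {N : Network V} {K : ℕ}

theorem Exec.silent (f : LocalInput → Register → Register) (σ : V → Register) :
    Exec N K [silent f] σ (fun v => f (N.localInput v) (σ v)) :=
  ⟨fun _ _ _ => Nat.zero_le _, rfl⟩

/-- After `r` rounds of flooding, every vertex knows a value that is at least the maximum over the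
ball of radius `r`, and at most the maximum over all vertices. -/
theorem exec_flood (r : ℕ) (σ : V → Register) (hK : ∀ v, (σ v).val ≤ K) :
    ∃ g : V → ℕ, Exec N K (List.replicate r flood) σ (fun v => { σ v with val := g v }) ∧
      (∀ u v, Within N.graph r u v → (σ u).val ≤ g v) ∧
      ∀ B, (∀ u, (σ u).val ≤ B) → ∀ v, g v ≤ B := by
  induction r with
  | zero => exact ⟨fun v => (σ v).val, rfl, fun u v h => h ▸ le_rfl, fun B hB v => hB v⟩
  | succ r ih =>
    obtain ⟨g, h₁, h₂, h₃⟩ := ih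
    rw [List.replicate_succ']
    refine ⟨fun v => max (g v) ((N.localInput v).ports.sup
      (received N flood (fun v => { σ v with val := g v }) v)),
      h₁.append (Exec.single fun u v _ => h₃ K hK u), ?_, ?_⟩
    · rintro u v (h | ⟨w, hw, ha⟩)
      · exact (h₂ u v h).trans (le_max_left _ _)
      · refine (h₂ u w hw).trans (le_trans ?_ (le_max_right _ _))
        have := Finset.le_sup (f := received N flood (fun v => { σ v with val := g v }) v)
          (port_mem N ha.symm)
        rwa [received_port N _ _ ha.symm] at this
    · intro B hB v
      refine max_le (h₃ B hB v) (Finset.sup_le fun p hp => ?_)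
      obtain ⟨u, hu, rfl⟩ := (mem_ports N).1 hp
      rw [received_port N _ _ hu]
      exact h₃ B hB u

variable (N)

/-- The subgraph of the edges that both endpoints have selected. -/
def chosen (σ : V → Register) : SimpleGraph V where
  Adj u v := N.graph.Adj u v ∧ N.port u v ∈ (σ u).sel ∧ N.port v u ∈ (σ v).sel
  symm := ⟨fun _ _ h => ⟨h.1.symm, h.2.2, h.2.1⟩⟩
  loopless := ⟨fun u h => N.graph.loopless.irrefl u h.1⟩

/-- The endpoints of every edge agree on whether it is selected. -/
def Agree (σ : V → Register) : Prop :=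
  ∀ u v, N.graph.Adj u v → N.port u v ∈ (σ u).sel → N.port v u ∈ (σ v).sel

/-- The search trees after `t` rounds: they are rooted at the vertices in `W`, and their first
`a` layers consist of selected edges. -/
structure Search (W : V → Prop) (a t : ℕ) (σ : V → Register) : Prop where
  root_eq : ∀ c, W c → (σ c).root = N.ident c + 1
  sound : ∀ v, (σ v).root ≠ 0 → (σ v).dep ≤ t ∧
    ∃ c, W c ∧ (σ v).root = N.ident c + 1 ∧ Within N.graph (σ v).dep c v
  base : ∀ v, (σ v).root ≠ 0 → ((σ v).dep = 0 ↔ W v)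
  parent : ∀ v, (σ v).root ≠ 0 → (σ v).dep ≠ 0 → ∃ u, N.graph.Adj v u ∧
    (σ v).par = N.port v u ∧ (σ u).root = (σ v).root ∧ (σ u).dep < (σ v).dep ∧
    ((σ v).dep ≤ a → N.port v u ∈ (σ v).sel)

variable {N}

theorem chosen_adj {V : Type*} {N : Network V} {σ : V → Register} (h : Agree N σ) {u v : V} :
    (chosen N σ).Adj u v ↔ N.graph.Adj u v ∧ N.port u v ∈ (σ u).sel :=
  ⟨fun h => ⟨h.1, h.2.1⟩, fun h' => ⟨h'.1, h'.2, h u v h'.1 h'.2⟩⟩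

theorem exec_search_step {W : V → Prop} {a t : ℕ} {σ : V → Register} (hK : ∀ v, N.ident v + 1 ≤ K)
    (hs : Search N W a t σ) (hag : Agree N σ) (b : Bool) (hb : t < a → b = true) :
    ∃ r d p : V → ℕ, ∃ τ : V → Register,
      τ = (fun v => { σ v with root := r v, dep := d v, par := p v }) ∧
      Exec N K [search b (t + 1)] σ τ ∧ Search N W a (t + 1) τ ∧
      (∀ v, (σ v).root ≠ 0 → r v ≠ 0) ∧
      ∀ u v, N.graph.Adj u v → (b = true → (chosen N σ).Adj u v) → (σ u).root ≠ 0 → r v ≠ 0 := by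
  have hexec : Exec N K [search b (t + 1)] σ (round N (search b (t + 1)) σ) := by
    refine Exec.single fun u v _ => ?_
    by_cases h : (σ u).root = 0
    · simp [search, h]
    · obtain ⟨-, c, -, hc, -⟩ := hs.sound u h
      simp only [search]
      split
      · rw [hc]; exact hK c
      · exact Nat.zero_le _
  -- A vertex outside of the trees joins if one of its neighbours offers this.
  have hold : ∀ v, (σ v).root ≠ 0 → round N (search b (t + 1)) σ v = σ v := by
    intro v hv
    simp [round, search, hv]
  have hnew : ∀ v, (σ v).root = 0 → round N (search b (t + 1)) σ v = σ v ∨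
      ∃ u, N.graph.Adj v u ∧ (σ u).root ≠ 0 ∧ (b = true → N.port u v ∈ (σ u).sel) ∧
        round N (search b (t + 1)) σ v
          = { σ v with root := (σ u).root, dep := t + 1, par := N.port v u } := by
    intro v hv
    by_cases h : ∃ p ∈ (N.localInput v).ports, received N (search b (t + 1)) σ v p ≠ 0
    · right
      have h' : (σ v).root = 0 ∧
        ∃ p ∈ (N.localInput v).ports, received N (search b (t + 1)) σ v p ≠ 0 := ⟨hv, h⟩
      have hspec := h'.2.choose_spec
      have e : round N (search b (t + 1)) σ v
          = { σ v with root := received N (search b (t + 1)) σ v h'.2.choose, dep := t + 1,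
                       par := h'.2.choose } := by
        unfold round
        exact dif_pos h'
      obtain ⟨u, hu, hp⟩ := (mem_ports N).1 hspec.1
      rw [← hp, received_port N _ _ hu] at hspec e
      have hm := hspec.2
      simp only [search] at hm
      by_cases hc : b = true → N.port u v ∈ (σ u).sel
      · rw [if_pos hc] at hm
        refine ⟨u, hu, hm, hc, ?_⟩
        rw [e]
        simp only [search]
        rw [if_pos hc]
      · rw [if_neg hc] at hm
        exact absurd rfl hm
    · left
      unfold round
      exact dif_neg fun h' => h h'.2
  have hgrow : ∀ u v, N.graph.Adj u v → (b = true → (chosen N σ).Adj u v) → (σ u).root ≠ 0 →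
      (round N (search b (t + 1)) σ v).root ≠ 0 := by
    intro u v ha hc hu
    by_cases hv : (σ v).root = 0
    · have hm : received N (search b (t + 1)) σ v (N.port v u) ≠ 0 := by
        rw [received_port N _ _ ha.symm]
        simp only [search]
        rwa [if_pos fun hb => (hc hb).2.1]
      have h' : (σ v).root = 0 ∧
        ∃ p ∈ (N.localInput v).ports, received N (search b (t + 1)) σ v p ≠ 0 :=
        ⟨hv, _, port_mem N ha.symm, hm⟩
      have e : round N (search b (t + 1)) σ v
          = { σ v with root := received N (search b (t + 1)) σ v h'.2.choose, dep := t + 1,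
                       par := h'.2.choose } := by
        unfold round
        exact dif_pos h'
      rw [e]
      exact h'.2.choose_spec.2
    · rwa [hold v hv]
  refine ⟨fun v => (round N (search b (t + 1)) σ v).root,
    fun v => (round N (search b (t + 1)) σ v).dep, fun v => (round N (search b (t + 1)) σ v).par,
    round N (search b (t + 1)) σ, ?_, hexec, ?_, ?_, hgrow⟩
  · funext v
    by_cases hv : (σ v).root = 0
    · rcases hnew v hv with h | ⟨u, -, -, -, h⟩
      · simp only [h]
      · simp only [h]
    · simp only [hold v hv]
  · have hcases : ∀ v, round N (search b (t + 1)) σ v = σ v ∨ (σ v).root = 0 ∧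
      ∃ u, N.graph.Adj v u ∧ (σ u).root ≠ 0 ∧ (b = true → N.port u v ∈ (σ u).sel) ∧
        round N (search b (t + 1)) σ v
          = { σ v with root := (σ u).root, dep := t + 1, par := N.port v u } := by
      intro v
      by_cases hv : (σ v).root = 0
      · exact (hnew v hv).imp id fun h => ⟨hv, h⟩
      · exact Or.inl (hold v hv)
    have hne : ∀ c, W c → (σ c).root ≠ 0 := fun c hc => by rw [hs.root_eq c hc]; omega
    constructor
    · intro c hc
      rw [hold c (hne c hc), hs.root_eq c hc]
    · intro v hv
      rcases hcases v with h | ⟨-, u, hu, hr, -, h⟩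
      · rw [h] at hv ⊢
        obtain ⟨h₁, h₂⟩ := hs.sound v hv
        exact ⟨by omega, h₂⟩
      · rw [h]
        obtain ⟨h₁, c, hc, h₂, h₃⟩ := hs.sound u hr
        exact ⟨le_rfl, c, hc, h₂, Or.inr ⟨u, h₃.mono_right h₁, hu.symm⟩⟩
    · intro v hv
      rcases hcases v with h | ⟨h₀, u, hu, hr, -, h⟩
      · rw [h] at hv ⊢
        exact hs.base v hv
      · rw [h]
        simp only [Nat.add_eq_zero_iff, one_ne_zero, and_false, false_iff]
        exact fun hv => hne v hv h₀
    · intro v hv hd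
      rcases hcases v with h | ⟨h₀, u, hu, hr, hsel, h⟩
      · rw [h] at hv hd ⊢
        obtain ⟨u, h₁, h₂, h₃, h₄⟩ := hs.parent v hv hd
        have hu : (σ u).root ≠ 0 := by rwa [h₃]
        exact ⟨u, h₁, h₂, by rw [hold u hu]; exact ⟨h₃, h₄⟩⟩
      · refine ⟨u, hu, ?_⟩
        rw [h, hold u hr]
        exact ⟨rfl, rfl, Nat.lt_succ_of_le (hs.sound u hr).1,
          fun hta => hag u v hu.symm (hsel (hb hta))⟩
  · intro v hv
    change (round N (search b (t + 1)) σ v).root ≠ 0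
    rwa [hold v hv]

/-- The complete search: `a` rounds along selected edges, then two rounds along all edges. -/
theorem exec_search {W : V → Prop} {a : ℕ} {σ : V → Register} (hK : ∀ v, N.ident v + 1 ≤ K)
    (hs : Search N W a 0 σ) (hag : Agree N σ) :
    ∃ r d p : V → ℕ, ∃ τ : V → Register,
      τ = (fun v => { σ v with root := r v, dep := d v, par := p v }) ∧
      Exec N K ((List.range' 0 (a + 2)).map fun t => [search (decide (t < a)) (t + 1)]).flatten σ τ
      ∧ Search N W a (a + 2) τ ∧
      ∀ c u v, W c → Within (chosen N σ) a c u → Within N.graph 2 u v → r v ≠ 0 := by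
  have key := Exec.flatten (N := N) (K := K) (σ := σ)
    (ls := fun t => [search (decide (t < a)) (t + 1)])
    (fun t τ => ∃ r d p : V → ℕ, τ = (fun v => { σ v with root := r v, dep := d v, par := p v }) ∧
      Search N W a t τ ∧ ∀ c u v, W c → Within (chosen N σ) (min t a) c u →
        Within N.graph (t - a) u v → r v ≠ 0) 0 (a + 2)
  refine Exists.elim (key ?step ?start) ?finish
  case finish =>
    rintro τ ⟨hτ, r, d, p, e, h₁, h₂⟩
    refine ⟨r, d, p, τ, e, hτ, by simpa using h₁, ?_⟩
    simpa using h₂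
  case step =>
    rintro t τ - ht ⟨r, d, p, e, h₁, h₂⟩
    have hag' : Agree N τ := by subst e; exact hag
    have hch : chosen N τ = chosen N σ := by subst e; rfl
    obtain ⟨r', d', p', τ', e', h₃, h₄, h₅, h₆⟩ :=
      exec_search_step (K := K) hK h₁ hag' (decide (t < a)) (by simp)
    refine ⟨τ', h₃, r', d', p', ?_, h₄, ?_⟩
    · subst e' e; rfl
    · intro c u v hc hu hv
      have hroot : ∀ v, (τ v).root = r v := fun v => by rw [e]
      simp only [hroot, hch] at h₅ h₆
      rcases lt_or_ge t a with hta | hta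
      · rw [show t + 1 - a = 0 by omega] at hv
        cases hv
        rw [min_eq_left (by omega)] at hu
        rcases hu with hu | ⟨w, hw, ha⟩
        · exact h₅ u (h₂ c u u hc (by rwa [min_eq_left hta.le]) (Within.refl _ _))
        · exact h₆ w u ha.1 (fun _ => ha)
            (h₂ c w w hc (by rwa [min_eq_left hta.le]) (Within.refl _ _))
      · rw [show t + 1 - a = (t - a) + 1 by omega] at hv
        rw [min_eq_right (by omega)] at hu
        rw [min_eq_right hta] at h₂
        rcases hv with hv | ⟨w, hw, ha⟩
        · exact h₅ v (h₂ c u v hc hu hv)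
        · exact h₆ w v ha (fun h => absurd (of_decide_eq_true h) (by omega)) (h₂ c u w hc hu hw)
  case start =>
    refine ⟨_, _, _, rfl, hs, ?_⟩
    intro c u v hc hu hv
    simp only [Nat.zero_min, Nat.zero_sub] at hu hv
    cases hu
    cases hv
    rw [hs.root_eq c hc]
    omega

end Search

/-! ### Counting along search trees -/

section Gather

open scoped Classical

/-- The vertices of depth `s` pass their counters on to their parents; edges that
carry a nonzero count are selected. -/
noncomputable def gather (s : ℕ) : Instr where
  send _ st p := if st.root ≠ 0 ∧ st.dep = s ∧ p = st.par then st.cnt else 0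
  recv x st m :=
    { st with
      cnt := (if st.root ≠ 0 ∧ st.dep = s then 0 else st.cnt) + ∑ p ∈ x.ports, m p
      sel := st.sel ∪ (x.ports.filter fun p => m p ≠ 0) ∪
        if st.root ≠ 0 ∧ st.dep = s ∧ st.cnt ≠ 0 then {st.par} else ∅ }

variable {V : Type*} [Fintype V] (N : Network V)

/-- The number of ordered pairs of vertices that are joined by a selected edge. -/
noncomputable def selCount (σ : V → Register) : ℕ :=
  (Finset.univ.filter fun e : V × V => (chosen N σ).Adj e.1 e.2).card

/-- The active vertices that are reached by the search trees. -/
noncomputable def reached (σ : V → Register) : Finset V :=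
  Finset.univ.filter fun v => (σ v).act ∧ (σ v).root ≠ 0

/-- The state of the count when only vertices of depth at most `s` have nonzero counters:
the total of the counters in a tree is the number of active vertices in it, and for every such
vertex `y` there is a vertex with nonzero counter on the way from `y` to the root. Only the
edges above depth `a` may be new. -/
structure Gathering (a s c₀ : ℕ) (σ : V → Register) : Prop where
  supp : ∀ v, (σ v).cnt ≠ 0 → (σ v).root ≠ 0 ∧ (σ v).dep ≤ s
  sum : ∀ f : ℕ → ℕ, ∑ v, f (σ v).root * (σ v).cnt = ∑ v ∈ reached σ, f (σ v).root
  path : ∀ y ∈ reached σ, ∃ v, (σ v).cnt ≠ 0 ∧ (σ v).root = (σ y).root ∧ (σ v).dep ≤ (σ y).dep ∧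
    Within (chosen N σ) ((σ y).dep - (σ v).dep) y v
  agree : Agree N σ
  count : selCount N σ ≤ c₀ + 2 * min (a + 2 - s) 2 * (reached σ).card

variable {N} {K : ℕ}

/-- A round in which edges become selected because a message passes along them. -/
theorem select_edges {σ τ : V → Register} {moves : V → V → Prop} (hag : Agree N σ)
    (hadj : ∀ u v, moves u v → N.graph.Adj u v)
    (hmem : ∀ v u, N.graph.Adj v u →
      (N.port v u ∈ (τ v).sel ↔ N.port v u ∈ (σ v).sel ∨ moves u v ∨ moves v u)) :
    Agree N τ ∧
      (∀ u v, (chosen N τ).Adj u v ↔ (chosen N σ).Adj u v ∨ moves u v ∨ moves v u) ∧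
      ∀ M : Finset (V × V), (∀ u v, moves u v → (u, v) ∈ M) →
        selCount N τ ≤ selCount N σ + 2 * M.card := by
  have hagree : Agree N τ := by
    intro u v ha h
    rw [hmem u v ha] at h
    rw [hmem v u ha.symm]
    rcases h with h | h | h
    · exact Or.inl (hag u v ha h)
    · exact Or.inr (Or.inr h)
    · exact Or.inr (Or.inl h)
  have hadj' : ∀ u v, (chosen N τ).Adj u v ↔ (chosen N σ).Adj u v ∨ moves u v ∨ moves v u := by
    intro u v
    rw [chosen_adj hagree, chosen_adj hag]
    constructor
    · rintro ⟨ha, h⟩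
      rcases (hmem u v ha).1 h with h | h | h
      · exact Or.inl ⟨ha, h⟩
      · exact Or.inr (Or.inr h)
      · exact Or.inr (Or.inl h)
    · rintro (⟨ha, h⟩ | h | h)
      · exact ⟨ha, (hmem u v ha).2 (Or.inl h)⟩
      · exact ⟨hadj u v h, (hmem u v (hadj u v h)).2 (Or.inr (Or.inr h))⟩
      · exact ⟨(hadj v u h).symm, (hmem u v (hadj v u h).symm).2 (Or.inr (Or.inl h))⟩
  refine ⟨hagree, hadj', fun M hM => ?_⟩
  have hsub : (Finset.univ.filter fun e : V × V => (chosen N τ).Adj e.1 e.2) ⊆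
      (Finset.univ.filter fun e : V × V => (chosen N σ).Adj e.1 e.2) ∪
        (M ∪ M.image Prod.swap) := by
    rintro ⟨u, v⟩ he
    have he := (Finset.mem_filter.1 he).2
    simp only [Finset.mem_union, Finset.mem_filter, Finset.mem_univ, true_and,
      Finset.mem_image, Prod.exists, Prod.swap_prod_mk, Prod.mk.injEq]
    rcases (hadj' u v).1 he with h | h | h
    · exact Or.inl h
    · exact Or.inr (Or.inl (hM u v h))
    · exact Or.inr (Or.inr ⟨v, u, hM v u h, rfl, rfl⟩)
  have h₁ : selCount N τ ≤ selCount N σ + (M.card + M.card) :=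
    (Finset.card_le_card hsub).trans ((Finset.card_union_le _ _).trans
      (Nat.add_le_add_left ((Finset.card_union_le _ _).trans
        (Nat.add_le_add_left Finset.card_image_le _)) _))
  omega

theorem Gathering.cnt_le {a s c₀ : ℕ} {σ : V → Register} (hg : Gathering N a s c₀ σ)
    (S : Finset V) : ∑ v ∈ S, (σ v).cnt ≤ (reached σ).card := by
  have := hg.sum fun _ => 1
  simp only [one_mul, Finset.sum_const, smul_eq_mul, mul_one] at this
  rw [← this]
  exact Finset.sum_le_sum_of_subset (Finset.subset_univ S)

/-- The total of the counters of a tree does not change, because the parent of a vertex is in the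
same tree. -/
theorem exec_gather_step {W : V → Prop} {a s L c₀ : ℕ} {σ : V → Register}
    (hK : Fintype.card V ≤ K) (hs : Search N W a L σ) (hg : Gathering N a (s + 1) c₀ σ)
    (hsa : s < a + 2) :
    ∃ n : V → ℕ, ∃ l : V → Finset ℕ, ∃ τ : V → Register,
      τ = (fun v => { σ v with cnt := n v, sel := l v }) ∧
      Exec N K [gather (s + 1)] σ τ ∧ Search N W a L τ ∧ Gathering N a s c₀ τ ∧
      chosen N σ ≤ chosen N τ := by
  have hexec : Exec N K [gather (s + 1)] σ (round N (gather (s + 1)) σ) := by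
    refine Exec.single fun u v _ => ?_
    simp only [gather]
    split
    · have := hg.cnt_le {u}
      rw [Finset.sum_singleton] at this
      exact this.trans ((Finset.card_le_univ _).trans hK)
    · exact Nat.zero_le _
  -- `moves u v`: a nonzero count passes from `u` to `v`.
  set moves : V → V → Prop := fun u v => N.graph.Adj u v ∧ (σ u).root ≠ 0 ∧ (σ u).dep = s + 1 ∧
    (σ u).par = N.port u v ∧ (σ u).cnt ≠ 0 with hmoves
  set τ := round N (gather (s + 1)) σ with hτ
  have hmove : ∀ u, (σ u).root ≠ 0 → (σ u).dep = s + 1 → ∃ w, N.graph.Adj u w ∧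
      (σ u).par = N.port u w ∧ (σ w).root = (σ u).root ∧ (σ w).dep < s + 1 ∧
      (s + 1 ≤ a → N.port u w ∈ (σ u).sel) := by
    intro u hr hd
    obtain ⟨w, h₁, h₂, h₃, h₄, h₅⟩ := hs.parent u hr (by omega)
    exact ⟨w, h₁, h₂, h₃, by omega, fun h => h₅ (by omega)⟩
  have hpar : ∀ u v, moves u v → (σ v).root = (σ u).root ∧ (σ v).dep < s + 1 ∧
      (s + 1 ≤ a → N.port u v ∈ (σ u).sel) := by
    rintro u v ⟨h₁, h₂, h₃, h₄, -⟩
    obtain ⟨w, hw, hp, h⟩ := hmove u h₂ h₃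
    cases port_inj N h₁ hw (h₄.symm.trans hp)
    exact h
  have hmem : ∀ v u, N.graph.Adj v u →
      (N.port v u ∈ (τ v).sel ↔ N.port v u ∈ (σ v).sel ∨ moves u v ∨ moves v u) := by
    intro v u ha
    have h₁ : N.port v u ∈ (N.localInput v).ports.filter
        (fun p => received N (gather (s + 1)) σ v p ≠ 0) ↔ moves u v := by
      rw [Finset.mem_filter, received_port N _ _ ha]
      simp only [port_mem N ha, true_and, gather, hmoves, ha.symm]
      constructor
      · intro h
        split at h
        · next h' => exact ⟨h'.1, h'.2.1, h'.2.2.symm, h⟩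
        · exact absurd rfl h
      · rintro ⟨h₁, h₂, h₃, h₄⟩
        rwa [if_pos ⟨h₁, h₂, h₃.symm⟩]
    have h₂ : N.port v u ∈ (if (σ v).root ≠ 0 ∧ (σ v).dep = s + 1 ∧ (σ v).cnt ≠ 0
        then {(σ v).par} else ∅ : Finset ℕ) ↔ moves v u := by
      simp only [hmoves, ha, true_and]
      split
      · next h => rw [Finset.mem_singleton]; exact ⟨fun e => ⟨h.1, h.2.1, e.symm, h.2.2⟩,
          fun e => e.2.2.1.symm⟩
      · next h => exact ⟨fun e => absurd e (Finset.notMem_empty _),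
          fun e => absurd ⟨e.1, e.2.1, e.2.2.2⟩ h⟩
    change N.port v u ∈ (σ v).sel ∪ (N.localInput v).ports.filter
        (fun p => received N (gather (s + 1)) σ v p ≠ 0) ∪ (if (σ v).root ≠ 0 ∧ (σ v).dep = s + 1 ∧
        (σ v).cnt ≠ 0 then {(σ v).par} else ∅) ↔ _
    rw [Finset.mem_union, Finset.mem_union, h₁, h₂, or_assoc]
  obtain ⟨hagree, hadj, hselCount⟩ := select_edges hg.agree (fun u v h => h.1) hmem
  have hle : chosen N σ ≤ chosen N τ := fun u v h => (hadj u v).2 (Or.inl h)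
  have hcnt : ∀ v, (τ v).cnt = (if (σ v).root ≠ 0 ∧ (σ v).dep = s + 1 then 0 else (σ v).cnt) +
      ∑ u, if moves u v then (σ u).cnt else 0 := by
    intro v
    change (if (σ v).root ≠ 0 ∧ (σ v).dep = s + 1 then 0 else (σ v).cnt) +
      ∑ p ∈ (N.localInput v).ports, received N (gather (s + 1)) σ v p = _
    rw [sum_ports]
    congr 1
    refine Finset.sum_congr rfl fun u _ => ?_
    by_cases ha : N.graph.Adj v u
    · rw [if_pos ha, received_port N _ _ ha]
      simp only [gather, hmoves, ha.symm, true_and]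
      by_cases h : (σ u).root ≠ 0 ∧ (σ u).dep = s + 1 ∧ N.port u v = (σ u).par
      · rw [if_pos h]
        by_cases h0 : (σ u).cnt = 0
        · simp [h0]
        · rw [if_pos ⟨h.1, h.2.1, h.2.2.symm, h0⟩]
      · rw [if_neg h, if_neg]
        exact fun h' => h ⟨h'.1, h'.2.1, h'.2.2.1.symm⟩
    · rw [if_neg ha, if_neg]
      exact fun h => ha h.1.symm
  have hpos : ∀ u v, moves u v → (τ v).cnt ≠ 0 := by
    intro u v h
    have h₁ : (σ u).cnt ≤ ∑ u, if moves u v then (σ u).cnt else 0 := by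
      refine le_trans ?_ (Finset.single_le_sum (f := fun u => if moves u v then (σ u).cnt else 0)
        (fun _ _ => Nat.zero_le _) (Finset.mem_univ u))
      simp only [h, if_true, le_refl]
    have h₂ := h.2.2.2.2
    rw [hcnt v]
    omega
  have hreach : reached τ = reached σ := rfl
  refine ⟨fun v => (τ v).cnt, fun v => (τ v).sel, τ, rfl, hexec, ?_, ?_, hle⟩
  · refine ⟨hs.root_eq, hs.sound, hs.base, fun v hv hd => ?_⟩
    obtain ⟨u, h₁, h₂, h₃, h₄, h₅⟩ := hs.parent v hv hd
    exact ⟨u, h₁, h₂, h₃, h₄, fun h => (hmem v u h₁).2 (Or.inl (h₅ h))⟩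
  · refine ⟨?_, ?_, ?_, hagree, ?_⟩
    · intro v hv
      change (σ v).root ≠ 0 ∧ (σ v).dep ≤ s
      by_cases h : ∃ u, moves u v
      · obtain ⟨u, hu⟩ := h
        obtain ⟨h₁, h₂, -⟩ := hpar u v hu
        exact ⟨by rw [h₁]; exact hu.2.1, by omega⟩
      · rw [hcnt v, Finset.sum_eq_zero fun u _ => if_neg fun hu => h ⟨u, hu⟩, add_zero] at hv
        split at hv
        · exact absurd rfl hv
        · next h' =>
          obtain ⟨h₁, h₂⟩ := hg.supp v hv
          refine ⟨h₁, ?_⟩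
          have : (σ v).dep ≠ s + 1 := fun e => h' ⟨h₁, e⟩
          omega
    · intro f
      rw [hreach]
      change ∑ v, f (σ v).root * (τ v).cnt = ∑ v ∈ reached σ, f (σ v).root
      rw [← hg.sum f]
      have e₁ : ∀ v, f (σ v).root * (τ v).cnt =
          (if (σ v).root ≠ 0 ∧ (σ v).dep = s + 1 then 0 else f (σ v).root * (σ v).cnt) +
          ∑ u, if moves u v then f (σ u).root * (σ u).cnt else 0 := by
        intro v
        rw [hcnt v, mul_add, Finset.mul_sum]
        congr 1
        · split <;> simp
        · refine Finset.sum_congr rfl fun u _ => ?_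
          split
          · next h => rw [(hpar u v h).1]
          · simp
      have e₂ : ∀ u, (∑ v, if moves u v then f (σ u).root * (σ u).cnt else 0) =
          if (σ u).root ≠ 0 ∧ (σ u).dep = s + 1 then f (σ u).root * (σ u).cnt else 0 := by
        intro u
        by_cases h : (σ u).root ≠ 0 ∧ (σ u).dep = s + 1 ∧ (σ u).cnt ≠ 0
        · obtain ⟨w, hw, hp, -⟩ := hmove u h.1 h.2.1
          rw [if_pos ⟨h.1, h.2.1⟩, Finset.sum_eq_single w]
          · rw [if_pos ⟨hw, h.1, h.2.1, hp, h.2.2⟩]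
          · intro v _ hv
            exact if_neg fun hm => hv (port_inj N hm.1 hw (hm.2.2.2.1.symm.trans hp))
          · exact fun h => absurd (Finset.mem_univ _) h
        · rw [Finset.sum_eq_zero fun v _ => if_neg fun hm => h ⟨hm.2.1, hm.2.2.1, hm.2.2.2.2⟩]
          split
          · next h' =>
            have : (σ u).cnt = 0 := by
              by_contra h0
              exact h ⟨h'.1, h'.2, h0⟩
            rw [this, mul_zero]
          · rfl
      simp only [e₁]
      rw [Finset.sum_add_distrib, Finset.sum_comm]
      simp only [e₂]
      rw [← Finset.sum_add_distrib]
      refine Finset.sum_congr rfl fun v _ => ?_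
      split <;> simp
    · intro y hy
      obtain ⟨v, h₁, h₂, h₃, h₄⟩ := hg.path y hy
      obtain ⟨h₅, h₆⟩ := hg.supp v h₁
      by_cases hd : (σ v).dep = s + 1
      · obtain ⟨w, hw, hp, hr, hlt, -⟩ := hmove v h₅ hd
        have hm : moves v w := ⟨hw, h₅, hd, hp, h₁⟩
        refine ⟨w, hpos v w hm, hr.trans h₂, ?_, ?_⟩
        · change (σ w).dep ≤ (σ y).dep
          omega
        · have : Within (chosen N τ) 1 v w := Within.of_adj ((hadj v w).2 (Or.inr (Or.inl hm)))
          refine ((h₄.mono hle).trans this).mono_right ?_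
          change _ ≤ (σ y).dep - (σ w).dep
          omega
      · refine ⟨v, ?_, h₂, h₃, h₄.mono hle⟩
        rw [hcnt v, if_neg fun h => hd h.2]
        omega
    · rw [hreach]
      by_cases hle_a : s + 1 ≤ a
      · have : chosen N τ = chosen N σ := by
          refine le_antisymm (fun u v h => ?_) hle
          rcases (hadj u v).1 h with h | h | h
          · exact h
          · exact (chosen_adj hg.agree).2 ⟨h.1, (hpar u v h).2.2 hle_a⟩
          · exact ((chosen_adj hg.agree).2 ⟨h.1, (hpar v u h).2.2 hle_a⟩).symm
        have hc := hg.count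
        rw [min_eq_right (by omega)] at hc ⊢
        rwa [selCount, this]
      · set M := Finset.univ.filter fun e : V × V => moves e.1 e.2 with hM
        have hMcard : M.card ≤ (reached σ).card := by
          calc M.card ≤ (Finset.univ.filter fun u : V => (σ u).cnt ≠ 0).card := by
                refine Finset.card_le_card_of_injOn Prod.fst ?_ ?_
                · intro e he
                  simp only [hM, Finset.mem_coe, Finset.mem_filter, Finset.mem_univ,
                    true_and] at he
                  simpa using he.2.2.2.2
                · rintro ⟨u, v⟩ he ⟨u', v'⟩ he' h
                  simp only [hM, Finset.mem_coe, Finset.mem_filter, Finset.mem_univ,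
                    true_and] at he he'
                  cases h
                  cases port_inj N he.1 he'.1 (he.2.2.2.1.symm.trans he'.2.2.2.1)
                  rfl
            _ = ∑ u ∈ Finset.univ.filter fun u : V => (σ u).cnt ≠ 0, 1 := by simp
            _ ≤ ∑ u ∈ Finset.univ.filter fun u : V => (σ u).cnt ≠ 0, (σ u).cnt := by
                refine Finset.sum_le_sum fun u hu => ?_
                have := (Finset.mem_filter.1 hu).2
                omega
            _ ≤ _ := hg.cnt_le _
        have hc := hg.count
        have h₁ : selCount N τ ≤ selCount N σ + 2 * M.card := 
          hselCount M fun u v h => Finset.mem_filter.2 ⟨Finset.mem_univ _, h⟩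
        rw [show min (a + 2 - s) 2 = min (a + 2 - (s + 1)) 2 + 1 by omega]
        nlinarith

theorem exec_gather {W : V → Prop} {a L c₀ : ℕ} {σ : V → Register}
    (hK : Fintype.card V ≤ K) (hs : Search N W a L σ) (hg : Gathering N a (a + 2) c₀ σ) :
    ∃ n : V → ℕ, ∃ l : V → Finset ℕ, ∃ τ : V → Register,
      τ = (fun v => { σ v with cnt := n v, sel := l v }) ∧
      Exec N K ((List.range' 0 (a + 2)).map fun t => [gather (a + 2 - t)]).flatten σ τ ∧
      Search N W a L τ ∧ Gathering N a 0 c₀ τ ∧ chosen N σ ≤ chosen N τ := by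
  have key := Exec.flatten (N := N) (K := K) (σ := σ) (ls := fun t => [gather (a + 2 - t)])
    (fun t τ => ∃ n : V → ℕ, ∃ l : V → Finset ℕ,
      τ = (fun v => { σ v with cnt := n v, sel := l v }) ∧
      Search N W a L τ ∧ Gathering N a (a + 2 - t) c₀ τ ∧ chosen N σ ≤ chosen N τ) 0 (a + 2)
  refine Exists.elim (key ?step ?start) ?finish
  case finish =>
    rintro τ ⟨hτ, n, l, e, h₁, h₂, h₃⟩
    exact ⟨n, l, τ, e, hτ, h₁, by simpa using h₂, h₃⟩
  case step =>
    rintro t τ - ht ⟨n, l, e, h₁, h₂, h₃⟩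
    rw [show a + 2 - t = (a + 2 - (t + 1)) + 1 by omega] at h₂ ⊢
    obtain ⟨n', l', τ', e', h₄, h₅, h₆, h₇⟩ := exec_gather_step (K := K) hK h₁ h₂ (by omega)
    exact ⟨τ', h₄, n', l', by subst e' e; rfl, h₅, h₆, h₃.trans h₇⟩
  case start => exact ⟨_, _, rfl, hs, hg, le_rfl⟩

end Gather

/-! ### The exploration of clusters -/

section Explore

open scoped Classical

/-- A root that has counted at least `thr` vertices decides to build a new cluster. -/
def decideNew (thr : ℕ) : LocalInput → Register → Register :=
  fun _ s => { s with dec := s.root ≠ 0 ∧ s.dep = 0 ∧ thr ≤ s.cnt }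

/-- The positive decision of the root passes down one layer of the search tree. -/
noncomputable def announce : Instr where
  send _ s _ := if s.dec then 1 else 0
  recv _ s m := { s with dec := s.dec ∨ s.root ≠ 0 ∧ s.dep ≠ 0 ∧ m s.par ≠ 0 }

/-- The candidates enter the competition with their identifiers. -/
noncomputable def startFlood : LocalInput → Register → Register :=
  fun x s => { s with val := if s.cand then x.ident + 1 else 0 }

/-- The candidates that have not heard of a larger one become roots of search trees. -/
noncomputable def startSearch : LocalInput → Register → Register :=
  fun x s => { s with root := if s.cand ∧ s.val = x.ident + 1 then x.ident + 1 else 0, dep := 0 }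

/-- The active vertices in the trees count for one. -/
noncomputable def startGather : LocalInput → Register → Register :=
  fun _ s => { s with cnt := if s.act ∧ s.root ≠ 0 then 1 else 0 }

/-- The active vertices whose root builds a new cluster are absorbed by it. -/
def finish : LocalInput → Register → Register :=
  fun _ s => { s with
    act := s.act ∧ ¬ s.dec
    taken := s.taken ∨ s.act ∧ s.dec
    next := s.next ∨ s.root ≠ 0 ∧ s.dep = 0 ∧ s.dec
    cand := s.cand ∧ ¬ (s.root ≠ 0 ∧ s.dep = 0) }

/-- Candidates that are the largest ones within distance `2 * (a + 2)` explore all vertices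
within two steps from the vertices that they can reach by `a` selected edges. -/
noncomputable def explore (a thr : ℕ) : List Instr :=
  [silent startFlood] ++ List.replicate (2 * (a + 2)) flood ++ [silent startSearch] ++
    ((List.range' 0 (a + 2)).map fun t => [search (decide (t < a)) (t + 1)]).flatten ++
    [silent startGather] ++ ((List.range' 0 (a + 2)).map fun t => [gather (a + 2 - t)]).flatten ++
    [silent (decideNew thr)] ++ List.replicate (a + 2) announce ++ [silent finish]

theorem length_explore (a thr : ℕ) : (explore a thr).length = 5 * a + 15 := by
  simp [explore, List.length_flatten, Function.comp_def]
  ring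

variable {V : Type*} [Fintype V] {N : Network V} {K : ℕ}

theorem exec_announce {W : V → Prop} {a L : ℕ} {σ : V → Register} (P : ℕ → Prop) (hK : 1 ≤ K)
    (hs : Search N W a L σ)
    (hdec : ∀ v, (σ v).dec ↔ (σ v).root ≠ 0 ∧ (σ v).dep = 0 ∧ P (σ v).root) :
    ∃ δ : V → Prop, Exec N K (List.replicate L announce) σ (fun v => { σ v with dec := δ v }) ∧
      ∀ v, δ v ↔ (σ v).root ≠ 0 ∧ P (σ v).root := by
  have key : ∀ t, ∃ δ : V → Prop,
      Exec N K (List.replicate t announce) σ (fun v => { σ v with dec := δ v }) ∧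
      (∀ v, δ v → (σ v).root ≠ 0 ∧ P (σ v).root) ∧
      ∀ v, (σ v).root ≠ 0 → (σ v).dep ≤ t → P (σ v).root → δ v := by
    intro t
    induction t with
    | zero =>
      exact ⟨fun v => (σ v).dec, rfl, fun v h => ⟨((hdec v).1 h).1, ((hdec v).1 h).2.2⟩,
        fun v h₁ h₂ h₃ => (hdec v).2 ⟨h₁, Nat.le_zero.1 h₂, h₃⟩⟩
    | succ t ih =>
      obtain ⟨δ, h₁, h₂, h₃⟩ := ih
      rw [List.replicate_succ']
      have hrec : ∀ v, (σ v).root ≠ 0 → (σ v).dep ≠ 0 → ∃ u, (σ u).root = (σ v).root ∧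
          (σ u).dep < (σ v).dep ∧ (received N announce (fun v => { σ v with dec := δ v }) v
            (σ v).par ≠ 0 ↔ δ u) := by
        intro v hv hd
        obtain ⟨u, ha, hp, hr, hlt, -⟩ := hs.parent v hv hd
        refine ⟨u, hr, hlt, ?_⟩
        rw [hp, received_port N _ _ ha]
        simp [announce]
      refine ⟨_, h₁.append (Exec.single fun u v _ => ?_), ?_, ?_⟩
      · simp only [announce]
        split
        · exact hK
        · exact Nat.zero_le _
      · rintro v (h | ⟨hv, hd, h⟩)
        · exact h₂ v h
        · obtain ⟨u, hr, -, hu⟩ := hrec v hv hd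
          refine ⟨hv, ?_⟩
          rw [← hr]
          exact (h₂ u (hu.1 h)).2
      · intro v hv ht hP
        by_cases hd : (σ v).dep = 0
        · exact Or.inl (h₃ v hv (by omega) hP)
        · obtain ⟨u, hr, hlt, hu⟩ := hrec v hv hd
          exact Or.inr ⟨hv, hd, hu.2 (h₃ u (by rwa [hr]) (by omega) (by rwa [hr]))⟩
  obtain ⟨δ, h₁, h₂, h₃⟩ := key L
  exact ⟨δ, h₁, fun v => ⟨h₂ v, fun h => h₃ v h.1 (hs.sound v h.1).1 h.2⟩⟩

variable (N)

/-- The outcome of an exploration: the winners `c ∈ W` have explored disjoint sets `Z c` of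
active vertices, and those that are large have become new clusters. -/
structure Explored (a thr : ℕ) (σ τ : V → Register) (W : Finset V) (Z : V → Finset V) : Prop where
  cand_of : ∀ c ∈ W, (σ c).cand
  nonempty : (∃ c, (σ c).cand) → W.Nonempty
  act_of : ∀ c ∈ W, ∀ y ∈ Z c, (σ y).act
  disjoint : (W : Set V).PairwiseDisjoint Z
  cover : ∀ c ∈ W, ∀ x y, Within (chosen N σ) a c x → Within N.graph 2 x y → (σ y).act → y ∈ Z c
  near : ∀ c ∈ W, ∀ y ∈ Z c, Within (chosen N τ) (a + 2) c y
  agree : Agree N τ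
  le : chosen N σ ≤ chosen N τ
  count : selCount N τ ≤ selCount N σ + 4 * ∑ c ∈ W, (Z c).card
  act_iff : ∀ y, (τ y).act ↔ (σ y).act ∧ ¬ ∃ c ∈ W, y ∈ Z c ∧ thr ≤ (Z c).card
  taken_iff : ∀ y, (τ y).taken ↔ (σ y).taken ∨ ∃ c ∈ W, y ∈ Z c ∧ thr ≤ (Z c).card
  next_iff : ∀ c, (τ c).next ↔ (σ c).next ∨ c ∈ W ∧ thr ≤ (Z c).card
  cand_iff : ∀ c, (τ c).cand ↔ (σ c).cand ∧ c ∉ W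
  frame : ∀ v, (τ v).rep = (σ v).rep ∧ (τ v).head = (σ v).head ∧ (τ v).up = (σ v).up

variable {N}

theorem exec_explore (a thr : ℕ) {σ : V → Register} (hK₁ : 1 ≤ K)
    (hK : Fintype.card V ≤ K) (hid : ∀ v, N.ident v + 1 ≤ K) (hag : Agree N σ) :
    ∃ W Z τ, Exec N K (explore a thr) σ τ ∧ Explored N a thr σ τ W Z := by
  set σ₁ : V → Register := fun v =>
    { σ v with val := if (σ v).cand then N.ident v + 1 else 0 } with hσ₁
  have hval : ∀ v, (σ₁ v).val = if (σ v).cand then N.ident v + 1 else 0 := fun v => rfl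
  obtain ⟨g, hx₁, hlo, hhi⟩ := exec_flood (N := N) (K := K) (2 * (a + 2)) σ₁ fun v => by
    rw [hval]
    split
    · exact hid v
    · exact Nat.zero_le _
  set W : Finset V := Finset.univ.filter fun c => (σ c).cand ∧ g c = N.ident c + 1 with hW
  have memW : ∀ c, c ∈ W ↔ (σ c).cand ∧ g c = N.ident c + 1 := fun c => by simp [hW]
  have hsep : ∀ c ∈ W, ∀ d ∈ W, Within N.graph (2 * (a + 2)) c d → c = d := by
    intro c hc d hd h
    rw [memW] at hc hd
    have h₁ := hlo c d h
    have h₂ := hlo d c h.symm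
    rw [hval, if_pos hc.1, hd.2] at h₁
    rw [hval, if_pos hd.1, hc.2] at h₂
    exact N.ident_injective (by omega)
  set σ₂ : V → Register := fun v => { σ₁ v with
    val := g v, root := if (σ v).cand ∧ g v = N.ident v + 1 then N.ident v + 1 else 0, dep := 0 }
    with hσ₂
  have hs₂ : Search N (· ∈ W) a 0 σ₂ := by
    have hroot : ∀ v, (σ₂ v).root = if v ∈ W then N.ident v + 1 else 0 := fun v => by
      simp only [memW, hσ₂]
    have hmem : ∀ v, (σ₂ v).root ≠ 0 → v ∈ W := fun v hv => by
      rw [hroot] at hv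
      by_contra h
      exact hv (if_neg h)
    refine ⟨fun c hc => (hroot c).trans (if_pos hc), fun v hv => ⟨le_rfl, v, hmem v hv,
      (hroot v).trans (if_pos (hmem v hv)), Within.refl _ _⟩,
      fun v hv => ⟨fun _ => hmem v hv, fun _ => rfl⟩, fun v _ hd => absurd rfl hd⟩
  have hag₂ : Agree N σ₂ := hag
  have hch₂ : chosen N σ₂ = chosen N σ := rfl
  obtain ⟨r, d, p, σ₃, e₃, hx₃, hs₃, hcov⟩ := exec_search (K := K) hid hs₂ hag₂
  set σ₄ : V → Register := fun v =>
    { σ₃ v with cnt := if (σ₃ v).act ∧ (σ₃ v).root ≠ 0 then 1 else 0 } with hσ₄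
  have hs₄ : Search N (· ∈ W) a (a + 2) σ₄ := ⟨hs₃.root_eq, hs₃.sound, hs₃.base, hs₃.parent⟩
  have hch₄ : chosen N σ₄ = chosen N σ := by
    rw [hσ₄, e₃]; rfl
  have hag₄ : Agree N σ₄ := by
    rw [hσ₄, e₃]; exact hag
  have hcnt₄ : ∀ v, (σ₄ v).cnt = if v ∈ reached σ₄ then 1 else 0 := fun v => by
    simp [reached, hσ₄]
  have hg₄ : Gathering N a (a + 2) (selCount N σ₄) σ₄ := by
    refine ⟨fun v hv => ?_, fun f => ?_, fun y hy => ?_, hag₄, by simp⟩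
    · have : v ∈ reached σ₄ := by
        by_contra h
        exact hv ((hcnt₄ v).trans (if_neg h))
      have := (Finset.mem_filter.1 this).2.2
      exact ⟨this, (hs₄.sound v this).1⟩
    · simp only [hcnt₄, mul_ite, mul_one, mul_zero, Finset.sum_ite_mem, Finset.univ_inter]
    · exact ⟨y, by simp [hcnt₄, hy], rfl, le_rfl, Within.refl _ _⟩
  obtain ⟨n, l, σ₅, e₅, hx₅, hs₅, hg₅, hle₅⟩ := exec_gather (K := K) hK hs₄ hg₄
  have hact₅ : ∀ v, (σ₅ v).act = (σ v).act := fun v => by rw [e₅, hσ₄, e₃]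
  -- At the end only the roots have nonzero counters.
  set Z : V → Finset V := fun c =>
    Finset.univ.filter fun y => (σ y).act ∧ (σ₅ y).root = N.ident c + 1 with hZ
  have memZ : ∀ c y, y ∈ Z c ↔ (σ y).act ∧ (σ₅ y).root = N.ident c + 1 := fun c y => by simp [hZ]
  have hroot₅ : ∀ v, (σ₅ v).root ≠ 0 → ∃ c ∈ W, (σ₅ v).root = N.ident c + 1 := fun v hv => by
    obtain ⟨-, c, h₁, h₂, -⟩ := hs₅.sound v hv
    exact ⟨c, h₁, h₂⟩
  have hcount : ∀ c ∈ W, (σ₅ c).cnt = (Z c).card := by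
    intro c hc
    have h := hg₅.sum fun ρ => if ρ = N.ident c + 1 then 1 else 0
    rw [Finset.sum_eq_single c] at h
    · rw [hs₅.root_eq c hc, if_pos rfl, one_mul] at h
      rw [h, ← Finset.sum_filter, Finset.sum_const, smul_eq_mul, mul_one]
      congr 1
      ext y
      simp only [reached, Finset.mem_filter, Finset.mem_univ, true_and, hact₅, memZ]
      constructor
      · rintro ⟨⟨h₁, -⟩, h₂⟩; exact ⟨h₁, h₂⟩
      · rintro ⟨h₁, h₂⟩; exact ⟨⟨h₁, by omega⟩, h₂⟩
    · intro v _ hv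
      by_contra h0
      rw [mul_eq_zero, not_or] at h0
      obtain ⟨h₁, h₂⟩ := hg₅.supp v h0.2
      have hvW : v ∈ W := (hs₅.base v h₁).1 (Nat.le_zero.1 h₂)
      have h₃ := h0.1
      rw [hs₅.root_eq v hvW] at h₃
      have h₄ : N.ident v + 1 = N.ident c + 1 := by
        by_contra h₅
        exact h₃ (if_neg h₅)
      exact hv (N.ident_injective (by omega))
    · exact fun h => absurd (Finset.mem_univ _) h
  set P : ℕ → Prop := fun ρ => ∃ c ∈ W, ρ = N.ident c + 1 ∧ thr ≤ (Z c).card with hP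
  set σ₆ : V → Register := fun v => { σ₅ v with
    dec := (σ₅ v).root ≠ 0 ∧ (σ₅ v).dep = 0 ∧ thr ≤ (σ₅ v).cnt } with hσ₆
  have hs₆ : Search N (· ∈ W) a (a + 2) σ₆ := ⟨hs₅.root_eq, hs₅.sound, hs₅.base, hs₅.parent⟩
  have hdec₆ : ∀ v, (σ₆ v).dec ↔ (σ₆ v).root ≠ 0 ∧ (σ₆ v).dep = 0 ∧ P (σ₆ v).root := by
    intro v
    change (σ₅ v).root ≠ 0 ∧ (σ₅ v).dep = 0 ∧ thr ≤ (σ₅ v).cnt ↔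
      (σ₅ v).root ≠ 0 ∧ (σ₅ v).dep = 0 ∧ P (σ₅ v).root
    refine and_congr_right fun hv => and_congr_right fun hd => ?_
    have hvW : v ∈ W := (hs₅.base v hv).1 hd
    rw [hcount v hvW, hP, hs₅.root_eq v hvW]
    constructor
    · exact fun h => ⟨v, hvW, rfl, h⟩
    · rintro ⟨c, -, h₁, h₂⟩
      cases N.ident_injective (Nat.succ_injective h₁)
      exact h₂
  obtain ⟨δ, hx₆, hδ⟩ := exec_announce P hK₁ hs₆ hdec₆
  have hδ' : ∀ v, (σ v).act → (δ v ↔ ∃ c ∈ W, v ∈ Z c ∧ thr ≤ (Z c).card) := by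
    intro v hv
    rw [hδ]
    constructor
    · rintro ⟨-, c, hc, h₁, h₂⟩
      exact ⟨c, hc, (memZ c v).2 ⟨hv, h₁⟩, h₂⟩
    · rintro ⟨c, hc, h₁, h₂⟩
      have h₁ : (σ₆ v).root = N.ident c + 1 := ((memZ c v).1 h₁).2
      exact ⟨by omega, c, hc, h₁, h₂⟩
  have hbase : ∀ c, ((σ₅ c).root ≠ 0 ∧ (σ₅ c).dep = 0) ↔ c ∈ W := by
    intro c
    constructor
    · exact fun h => (hs₅.base c h.1).1 h.2
    · intro hc
      have : (σ₅ c).root ≠ 0 := by rw [hs₅.root_eq c hc]; omega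
      exact ⟨this, (hs₅.base c this).2 hc⟩
  set τ : V → Register := fun v => finish (N.localInput v) { σ₆ v with dec := δ v } with hτ
  have hchτ : chosen N τ = chosen N σ₅ := rfl
  refine ⟨W, Z, τ, ?_, ?_⟩
  · refine Exec.append (Exec.append (Exec.append (Exec.append (Exec.append (Exec.append
      (Exec.append (Exec.append (Exec.silent startFlood σ) hx₁) (Exec.silent startSearch _)) hx₃)
      (Exec.silent startGather _)) hx₅) (Exec.silent (decideNew thr) _)) hx₆) (Exec.silent finish _)
  have hZact : ∀ v, (∃ c ∈ W, v ∈ Z c ∧ thr ≤ (Z c).card) → (σ v).act := by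
    rintro v ⟨c, -, h, -⟩
    exact ((memZ c v).1 h).1
  have hdisj : (W : Set V).PairwiseDisjoint Z := by
    intro c hc d hd hcd
    refine Finset.disjoint_left.2 fun y h₁ h₂ => hcd (N.ident_injective ?_)
    have h₁ := ((memZ c y).1 h₁).2
    have h₂ := ((memZ d y).1 h₂).2
    omega
  constructor
  · exact fun c hc => ((memW c).1 hc).1
  · rintro ⟨c₀, hc₀⟩
    -- The candidate with the largest identifier wins.
    obtain ⟨c, hc, hmax⟩ := Finset.exists_max_image
      (Finset.univ.filter fun c => (σ c).cand) N.ident ⟨c₀, by simpa using hc₀⟩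
    have hc := (Finset.mem_filter.1 hc).2
    refine ⟨c, (memW c).2 ⟨hc, le_antisymm (hhi _ (fun u => ?_) c) ?_⟩⟩
    · rw [hval]
      split
      · next hu => exact Nat.succ_le_succ (hmax u (by simpa using hu))
      · exact Nat.zero_le _
    · have := hlo c c (Within.refl _ _)
      rwa [hval, if_pos hc] at this
  · exact fun c _ y hy => ((memZ c y).1 hy).1
  · exact hdisj
  · intro c hc x y hx hy hact
    refine (memZ c y).2 ⟨hact, ?_⟩
    have hroot : ∀ v, (σ₅ v).root = r v := fun v => by rw [e₅, hσ₄, e₃]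
    have hne : (σ₅ y).root ≠ 0 := by
      rw [hroot]
      exact hcov c x y hc hx hy
    obtain ⟨hd, c', hc', h₁, h₂⟩ := hs₅.sound y hne
    have hle : chosen N σ ≤ N.graph := fun _ _ h => h.1
    have h₃ : Within N.graph (2 * (a + 2)) c c' :=
      (((hx.mono hle).trans hy).trans (h₂.mono_right hd).symm).mono_right (by omega)
    rw [hsep c hc c' hc' h₃]
    exact h₁
  · intro c hc y hy
    obtain ⟨h₁, h₂⟩ := (memZ c y).1 hy
    have hne : (σ₅ y).root ≠ 0 := by omega
    obtain ⟨v, h₃, h₄, h₅, h₆⟩ := hg₅.path y (by simp [reached, hact₅, h₁, hne])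
    obtain ⟨h₇, h₈⟩ := hg₅.supp v h₃
    have hvW : v ∈ W := (hs₅.base v h₇).1 (Nat.le_zero.1 h₈)
    rw [h₂, hs₅.root_eq v hvW] at h₄
    cases N.ident_injective (Nat.succ_injective h₄)
    have := (hs₅.sound y hne).1
    rw [hchτ]
    exact h₆.symm.mono_right (by omega)
  · exact hg₅.agree
  · rw [hchτ, ← hch₄]
    exact hle₅
  · have h₁ : selCount N σ₄ = selCount N σ := by rw [selCount, hch₄, selCount]
    have h₂ : (reached σ₅).card = ∑ c ∈ W, (Z c).card := by
      rw [← Finset.card_biUnion hdisj]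
      congr 1
      ext y
      simp only [reached, Finset.mem_filter, Finset.mem_univ, true_and, Finset.mem_biUnion, memZ,
        hact₅]
      constructor
      · rintro ⟨h₁, h₂⟩
        obtain ⟨c, hc, h⟩ := hroot₅ y h₂
        exact ⟨c, hc, h₁, h⟩
      · rintro ⟨c, -, h₁, h⟩
        exact ⟨h₁, by omega⟩
    have h₃ := hg₅.count
    rw [h₁, h₂, min_eq_right (by omega)] at h₃
    exact h₃
  · intro y
    change (σ₅ y).act ∧ ¬ δ y ↔ _
    rw [hact₅]
    exact and_congr_right fun h => not_congr (hδ' y h)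
  · intro y
    change (σ₅ y).taken ∨ (σ₅ y).act ∧ δ y ↔ _
    rw [hact₅, show (σ₅ y).taken = (σ y).taken by rw [e₅, hσ₄, e₃]]
    refine or_congr_right ⟨fun h => (hδ' y h.1).1 h.2, fun h => ?_⟩
    exact ⟨hZact y h, (hδ' y (hZact y h)).2 h⟩
  · intro c
    change (σ₅ c).next ∨ (σ₅ c).root ≠ 0 ∧ (σ₅ c).dep = 0 ∧ δ c ↔ _
    rw [show (σ₅ c).next = (σ c).next by rw [e₅, hσ₄, e₃], ← and_assoc, hbase]
    refine or_congr_right (and_congr_right fun hc => ?_)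
    rw [hδ]
    change (σ₅ c).root ≠ 0 ∧ P (σ₅ c).root ↔ _
    rw [hs₅.root_eq c hc]
    constructor
    · rintro ⟨-, c', -, h₁, h₂⟩
      cases N.ident_injective (Nat.succ_injective h₁)
      exact h₂
    · exact fun h => ⟨by omega, c, hc, rfl, h⟩
  · intro c
    change (σ₅ c).cand ∧ ¬ ((σ₅ c).root ≠ 0 ∧ (σ₅ c).dep = 0) ↔ _
    rw [show (σ₅ c).cand = (σ c).cand by rw [e₅, hσ₄, e₃], hbase]
  · intro v
    change (σ₅ v).rep = _ ∧ (σ₅ v).head = _ ∧ (σ₅ v).up = _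
    rw [e₅, hσ₄, e₃]
    exact ⟨rfl, rfl, rfl⟩

end Explore

/-! ### Heads and loads -/

section Heads

open scoped Classical

/-- All vertices of `A` are active, and nothing is selected. -/
def initial (x : LocalInput) : Register where
  sel := ∅
  rep := ∅
  head := 0
  up := 0
  act := x.inA = true
  taken := False
  cand := False
  next := False
  val := 0
  root := 0
  dep := 0
  par := 0
  cnt := 0
  dec := False

/-- The vertices of `A` send their identifiers, and every vertex of `B` chooses one of its
neighbours as its head. -/
noncomputable def chooseHead : Instr where
  send x _ _ := if x.inA = true then x.ident + 1 else 0
  recv x s m :=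
    if h : x.inA = false ∧ ∃ p ∈ x.ports, m p ≠ 0 then
      { s with sel := {h.2.choose}, up := h.2.choose, head := m h.2.choose }
    else s

/-- The vertices of `B` send the identifiers of their heads, and every vertex of `A` chooses
one representative among the neighbours with the same head. -/
noncomputable def chooseReps : Instr where
  send x s _ := if x.inA = true then 0 else s.head
  recv x s m :=
    if x.inA = true then
      { s with
        sel := x.ports.filter fun p => m p = x.ident + 1
        rep := x.ports.filter fun p => ∀ p' ∈ x.ports, m p' = m p → p ≤ p' }
    else s

/-- Active vertices report to their representatives, which count the reports. -/
noncomputable def report : Instr where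
  send _ s p := if s.act ∧ p ∈ s.rep then 1 else 0
  recv x s m := { s with cnt := ∑ p ∈ x.ports, m p }

/-- The counts pass on to the heads, which become candidates if their load is at least `q`. -/
noncomputable def nominate (q : ℕ) : Instr where
  send x s p := if x.inA = false ∧ p = s.up then s.cnt else 0
  recv x s m := { s with cand := x.inA = true ∧ q ≤ ∑ p ∈ x.ports, m p }

/-- Active vertices select the edges to their representatives. -/
noncomputable def selectReps : Instr where
  send _ s p := if s.act ∧ p ∈ s.rep then 1 else 0
  recv x s m :=
    { s with sel := s.sel ∪ (x.ports.filter fun p => m p ≠ 0) ∪ if s.act then s.rep else ∅ }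

/-- The vertices of `B` look for a neighbour in a cluster. -/
noncomputable def findTaken : Instr where
  send _ s _ := if s.taken then 1 else 0
  recv x s m :=
    if h : x.inA = false ∧ ∃ p ∈ x.ports, m p ≠ 0 then { s with up := h.2.choose, cnt := 1 }
    else { s with cnt := 0 }

/-- The vertices of `B` select an edge to a neighbour in a cluster. -/
noncomputable def selectTaken : Instr where
  send _ s p := if s.cnt ≠ 0 ∧ p = s.up then 1 else 0
  recv x s m :=
    { s with
      sel := s.sel ∪ (x.ports.filter fun p => m p ≠ 0) ∪ if s.cnt ≠ 0 then {s.up} else ∅ }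

variable {V : Type*} [Fintype V] (N : Network V)

/-- `N.A` and its complement are the two sides of a bipartition. -/
def Bipartite : Prop := ∀ u v, N.graph.Adj u v → (u ∈ N.A ↔ v ∉ N.A)

/-- The choice of heads and representatives: the head of `b` is `π b`, and every
vertex of `A` has exactly one representative for each head among the heads of its neighbours. -/
structure Heads (π : V → V) (σ : V → Register) : Prop where
  adj : ∀ b y, b ∉ N.A → N.graph.Adj b y → N.graph.Adj b (π b)
  up_eq : ∀ b y, b ∉ N.A → N.graph.Adj b y → (σ b).up = N.port b (π b)
  exists_rep : ∀ y b, y ∈ N.A → N.graph.Adj y b →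
    ∃ b', N.graph.Adj y b' ∧ π b' = π b ∧ N.port y b' ∈ (σ y).rep
  unique_rep : ∀ y b b', y ∈ N.A → N.graph.Adj y b → N.graph.Adj y b' → π b = π b' →
    N.port y b ∈ (σ y).rep → N.port y b' ∈ (σ y).rep → b = b'

/-- The active vertices that have `b` as a representative. -/
noncomputable def clients (σ : V → Register) (b : V) : Finset V :=
  Finset.univ.filter fun y => N.graph.Adj b y ∧ (σ y).act ∧ N.port y b ∈ (σ y).rep

/-- The load of `x`: the number of active vertices that have a neighbour with head `x`. -/
noncomputable def load (π : V → V) (σ : V → Register) (x : V) : ℕ :=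
  ∑ b, if N.graph.Adj x b ∧ π b = x then (clients N σ b).card else 0

variable {N} {K : ℕ}

theorem inA_iff {v : V} : (N.localInput v).inA = true ↔ v ∈ N.A := by
  simp [Network.localInput]

theorem inA_eq_false_iff {v : V} : (N.localInput v).inA = false ↔ v ∉ N.A := by
  simp [Network.localInput]

theorem exec_setup (hbip : Bipartite N) (hid : ∀ v, N.ident v + 1 ≤ K) :
    ∃ π : V → V, ∃ τ : V → Register,
      Exec N K [chooseHead, chooseReps] (fun v => initial (N.localInput v)) τ ∧
      Heads N π τ ∧ Agree N τ ∧ (∀ b y, b ∉ N.A → N.graph.Adj b y → (chosen N τ).Adj b (π b)) ∧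
      selCount N τ ≤ 2 * (Finset.univ.filter fun v => v ∉ N.A).card ∧
      ∀ v, ((τ v).act ↔ v ∈ N.A) ∧ ¬ (τ v).taken ∧ ¬ (τ v).next := by
  set σ₀ : V → Register := fun v => initial (N.localInput v) with hσ₀
  set σ₁ := round N chooseHead σ₀ with hσ₁
  have hB₁ : ∀ b, ∃ w, ∀ y, b ∉ N.A → N.graph.Adj b y → N.graph.Adj b w ∧
      (σ₁ b).sel = {N.port b w} ∧ (σ₁ b).up = N.port b w ∧ (σ₁ b).head = N.ident w + 1 := by
    intro b
    by_cases hb : b ∉ N.A ∧ ∃ y, N.graph.Adj b y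
    · obtain ⟨hb, y, hy⟩ := hb
      have hrec : ∀ w, N.graph.Adj b w →
          received N chooseHead σ₀ b (N.port b w) = N.ident w + 1 := by
        intro w hw
        rw [received_port N _ _ hw]
        have : w ∈ N.A := (hbip w b hw.symm).2 hb
        exact if_pos (inA_iff.2 this)
      have h : (N.localInput b).inA = false ∧
          ∃ p ∈ (N.localInput b).ports, received N chooseHead σ₀ b p ≠ 0 :=
        ⟨inA_eq_false_iff.2 hb, _, port_mem N hy, by rw [hrec y hy]; omega⟩
      have e : σ₁ b = { σ₀ b with
          sel := {h.2.choose}, up := h.2.choose,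
          head := received N chooseHead σ₀ b h.2.choose } := by
        rw [hσ₁, round]
        exact dif_pos h
      obtain ⟨w, hw, hp⟩ := (mem_ports N).1 h.2.choose_spec.1
      rw [← hp, hrec w hw] at e
      exact ⟨w, fun _ _ _ => ⟨hw, by rw [e], by rw [e], by rw [e]⟩⟩
    · exact ⟨b, fun y h₁ h₂ => absurd ⟨h₁, y, h₂⟩ hb⟩
  choose π hπ using hB₁
  have hother : ∀ v, (σ₁ v).act = (σ₀ v).act ∧ (σ₁ v).taken = False ∧ (σ₁ v).next = False := by
    intro v
    rw [hσ₁, round]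
    simp only [chooseHead]
    split <;> exact ⟨rfl, rfl, rfl⟩
  set τ := round N chooseReps σ₁ with hτ
  have hB : ∀ b, b ∉ N.A → τ b = σ₁ b := by
    intro b hb
    rw [hτ, round]
    exact if_neg fun h => hb (inA_iff.1 h)
  have hAτ : ∀ y, y ∈ N.A → τ y = { σ₁ y with
      sel := (N.localInput y).ports.filter fun p =>
        received N chooseReps σ₁ y p = N.ident y + 1
      rep := (N.localInput y).ports.filter fun p => ∀ p' ∈ (N.localInput y).ports,
        received N chooseReps σ₁ y p' = received N chooseReps σ₁ y p → p ≤ p' } := by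
    intro y hy
    rw [hτ, round]
    exact if_pos (inA_iff.2 hy)
  have hrec : ∀ y b, y ∈ N.A → N.graph.Adj y b →
      received N chooseReps σ₁ y (N.port y b) = N.ident (π b) + 1 := by
    intro y b hy hb
    have hbA : b ∉ N.A := (hbip y b hb).1 hy
    rw [received_port N _ _ hb, ← (hπ b y hbA hb.symm).2.2.2]
    exact if_neg fun h => hbA (inA_iff.1 h)
  have hexec : Exec N K [chooseHead, chooseReps] σ₀ τ := by
    refine ⟨fun u v _ => ?_, fun u v ha => ?_, rfl⟩
    · simp only [chooseHead]
      split
      · exact hid u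
      · exact Nat.zero_le _
    · simp only [chooseReps]
      split
      · exact Nat.zero_le _
      · next hu =>
        have hu : u ∉ N.A := fun h => hu (inA_iff.2 h)
        change (σ₁ u).head ≤ K
        rw [(hπ u v hu ha).2.2.2]
        exact hid _
  have hselB : ∀ b y, b ∉ N.A → N.graph.Adj b y → (N.port b y ∈ (τ b).sel ↔ y = π b) := by
    intro b y hb hy
    obtain ⟨h₁, h₂, -⟩ := hπ b y hb hy
    rw [hB b hb, h₂, Finset.mem_singleton]
    exact ⟨fun h => port_inj N hy h₁ h, fun h => by rw [h]⟩
  have hselA : ∀ y b, y ∈ N.A → N.graph.Adj y b → (N.port y b ∈ (τ y).sel ↔ y = π b) := by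
    intro y b hy hb
    rw [hAτ y hy, Finset.mem_filter, hrec y b hy hb]
    constructor
    · exact fun h => (N.ident_injective (Nat.succ_injective h.2)).symm
    · exact fun h => ⟨port_mem N hb, by rw [← h]⟩
  have hagree : Agree N τ := by
    intro u v ha h
    by_cases hu : u ∈ N.A
    · have hv := (hbip u v ha).1 hu
      exact (hselB v u hv ha.symm).2 ((hselA u v hu ha).1 h)
    · have hv : v ∈ N.A := (hbip v u ha.symm).2 hu
      exact (hselA v u hv ha.symm).2 ((hselB u v hu ha).1 h)
  refine ⟨π, τ, hexec, ⟨?_, ?_, ?_, ?_⟩, hagree, ?_, ?_, ?_⟩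
  · exact fun b y hb hy => (hπ b y hb hy).1
  · exact fun b y hb hy => by rw [hB b hb]; exact (hπ b y hb hy).2.2.1
  · intro y b hy hb
    obtain ⟨p, hp, hmin⟩ := Finset.exists_min_image ((N.localInput y).ports.filter fun p =>
      received N chooseReps σ₁ y p = N.ident (π b) + 1) id
      ⟨N.port y b, Finset.mem_filter.2 ⟨port_mem N hb, hrec y b hy hb⟩⟩
    rw [Finset.mem_filter] at hp
    obtain ⟨b', hb', rfl⟩ := (mem_ports N).1 hp.1
    have h := hp.2
    rw [hrec y b' hy hb'] at h
    refine ⟨b', hb', N.ident_injective (Nat.succ_injective h), ?_⟩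
    rw [hAτ y hy, Finset.mem_filter]
    refine ⟨hp.1, fun p' hp' h' => hmin p' (Finset.mem_filter.2 ⟨hp', ?_⟩)⟩
    rw [h', hp.2]
  · intro y b b' hy hb hb' hbb h h'
    rw [hAτ y hy, Finset.mem_filter] at h h'
    have e : received N chooseReps σ₁ y (N.port y b) = received N chooseReps σ₁ y (N.port y b') := by
      rw [hrec y b hy hb, hrec y b' hy hb', hbb]
    exact port_inj N hb hb' (le_antisymm (h.2 _ h'.1 e.symm) (h'.2 _ h.1 e))
  · intro b y hb hy
    have h := (hπ b y hb hy).1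
    exact (chosen_adj hagree).2 ⟨h, (hselB b (π b) hb h).2 rfl⟩
  · set D := Finset.univ.filter fun v => v ∉ N.A with hD
    have hsub : (Finset.univ.filter fun e : V × V => (chosen N τ).Adj e.1 e.2) ⊆
        (D.image fun b => (b, π b)) ∪ D.image fun b => (π b, b) := by
      rintro ⟨u, v⟩ he
      have he := (chosen_adj hagree).1 (Finset.mem_filter.1 he).2
      simp only [Finset.mem_union, Finset.mem_image, hD, Finset.mem_filter, Finset.mem_univ,
        true_and, Prod.mk.injEq]
      by_cases hu : u ∈ N.A
      · exact Or.inr ⟨v, (hbip u v he.1).1 hu, ((hselA u v hu he.1).1 he.2).symm, rfl⟩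
      · exact Or.inl ⟨u, hu, rfl, ((hselB u v hu he.1).1 he.2).symm⟩
    refine (Finset.card_le_card hsub).trans ((Finset.card_union_le _ _).trans ?_)
    rw [two_mul]
    exact Nat.add_le_add Finset.card_image_le Finset.card_image_le
  · intro v
    have h : (τ v).act = (σ₁ v).act ∧ (τ v).taken = (σ₁ v).taken ∧ (τ v).next = (σ₁ v).next := by
      by_cases hv : v ∈ N.A
      · rw [hAτ v hv]; exact ⟨rfl, rfl, rfl⟩
      · rw [hB v hv]; exact ⟨rfl, rfl, rfl⟩
    rw [h.1, h.2.1, h.2.2, (hother v).1, (hother v).2.1, (hother v).2.2]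
    exact ⟨inA_iff, id, id⟩

theorem sum_report (σ : V → Register) (b : V) :
    ∑ p ∈ (N.localInput b).ports, received N report σ b p = (clients N σ b).card := by
  rw [sum_ports, clients, Finset.card_filter]
  refine Finset.sum_congr rfl fun y _ => ?_
  by_cases ha : N.graph.Adj b y
  · rw [if_pos ha, received_port N _ _ ha]
    simp [report, ha]
  · rw [if_neg ha, if_neg fun h => ha h.1]

theorem exec_tally {π : V → V} {σ : V → Register} (hbip : Bipartite N) (hK₁ : 1 ≤ K)
    (hK : Fintype.card V ≤ K) (hh : Heads N π σ) (q : ℕ) :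
    ∃ n : V → ℕ, ∃ d : V → Prop,
      Exec N K [report, nominate q] σ (fun v => { σ v with cnt := n v, cand := d v }) ∧
      ∀ x, d x ↔ x ∈ N.A ∧ q ≤ load N π σ x := by
  set σ₁ : V → Register := fun v => { σ v with cnt := (clients N σ v).card } with hσ₁
  have e₁ : round N report σ = σ₁ := by
    funext v
    simp only [round, hσ₁, ← sum_report σ v]
    rfl
  refine ⟨fun v => (clients N σ v).card, fun v => (N.localInput v).inA = true ∧
    q ≤ ∑ p ∈ (N.localInput v).ports, received N (nominate q) σ₁ v p, ⟨?_, ?_⟩, ?_⟩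
  · intro u v _
    simp only [report]
    split
    · exact hK₁
    · exact Nat.zero_le _
  · rw [e₁]
    refine ⟨?_, rfl⟩
    intro u v _
    simp only [nominate]
    split
    · exact (Finset.card_le_univ _).trans hK
    · exact Nat.zero_le _
  · intro x
    beta_reduce
    rw [inA_iff]
    refine and_congr_right fun hx => ?_
    rw [sum_ports, load]
    suffices h : ∀ b, (if N.graph.Adj x b then received N (nominate q) σ₁ x (N.port x b) else 0) =
        if N.graph.Adj x b ∧ π b = x then (clients N σ b).card else 0 by
      simp only [h]
    intro b
    by_cases ha : N.graph.Adj x b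
    · have hb : b ∉ N.A := (hbip x b ha).1 hx
      rw [if_pos ha, received_port N _ _ ha]
      simp only [nominate, inA_eq_false_iff.2 hb, true_and, ha, hσ₁, hh.up_eq b x hb ha.symm]
      refine if_congr ?_ rfl rfl
      exact ⟨fun h => (port_inj N ha.symm (hh.adj b x hb ha.symm) h).symm, fun h => by rw [h]⟩
    · rw [if_neg ha, if_neg fun h => ha h.1]

/-- By the uniqueness of representatives, the load counts no vertex twice. -/
theorem load_le {π : V → V} {σ : V → Register} (hh : Heads N π σ)
    (hact : ∀ v, (σ v).act → v ∈ N.A) {x : V} {S : Finset V}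
    (hS : ∀ y, (σ y).act → Within N.graph 2 x y → y ∈ S) : load N π σ x ≤ S.card := by
  rw [load, ← Finset.sum_filter, ← Finset.card_biUnion]
  · refine Finset.card_le_card fun y hy => ?_
    simp only [Finset.mem_biUnion, Finset.mem_filter, Finset.mem_univ, true_and, clients] at hy
    obtain ⟨b, ⟨h₁, -⟩, h₂, h₃, -⟩ := hy
    exact hS y h₃ ((Within.of_adj h₁).trans (Within.of_adj h₂))
  · intro b hb b' hb' hne
    simp only [Finset.mem_coe, Finset.mem_filter, Finset.mem_univ, true_and] at hb hb'
    refine Finset.disjoint_left.2 fun y hy hy' => hne ?_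
    simp only [clients, Finset.mem_filter, Finset.mem_univ, true_and] at hy hy'
    exact hh.unique_rep y b b' (hact y hy.2.1) hy.1.symm hy'.1.symm (hb.2.trans hb'.2.symm)
      hy.2.2 hy'.2.2

theorem load_mono {π : V → V} {σ τ : V → Register} (hrep : ∀ v, (τ v).rep = (σ v).rep)
    (hact : ∀ v, (τ v).act → (σ v).act) (x : V) : load N π τ x ≤ load N π σ x := by
  refine Finset.sum_le_sum fun b _ => ?_
  split
  · refine Finset.card_le_card fun y hy => ?_
    simp only [clients, Finset.mem_filter, Finset.mem_univ, true_and] at hy ⊢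
    rw [hrep] at hy
    exact ⟨hy.1, hact y hy.2.1, hy.2.2⟩
  · exact le_rfl

theorem exec_selectReps {π : V → V} {σ : V → Register} (hbip : Bipartite N) (hK₁ : 1 ≤ K)
    (hh : Heads N π σ) (hag : Agree N σ) (hact : ∀ v, (σ v).act → v ∈ N.A) :
    ∃ l : V → Finset ℕ, ∃ τ : V → Register, τ = (fun v => { σ v with sel := l v }) ∧
      Exec N K [selectReps] σ τ ∧ Agree N τ ∧ chosen N σ ≤ chosen N τ ∧
      (∀ y b, (σ y).act → N.graph.Adj y b → N.port y b ∈ (σ y).rep → (chosen N τ).Adj y b) ∧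
      selCount N τ ≤ selCount N σ + 2 * ∑ x ∈ N.A, load N π σ x := by
  set moves : V → V → Prop := fun y b => N.graph.Adj y b ∧ (σ y).act ∧ N.port y b ∈ (σ y).rep
    with hmoves
  set τ := round N selectReps σ with hτ
  have hmem : ∀ v u, N.graph.Adj v u →
      (N.port v u ∈ (τ v).sel ↔ N.port v u ∈ (σ v).sel ∨ moves u v ∨ moves v u) := by
    intro v u ha
    change N.port v u ∈ (σ v).sel ∪ (N.localInput v).ports.filter
        (fun p => received N selectReps σ v p ≠ 0) ∪ (if (σ v).act then (σ v).rep else ∅) ↔ _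
    rw [Finset.mem_union, Finset.mem_union, Finset.mem_filter, received_port N _ _ ha, or_assoc]
    refine or_congr_right (or_congr ?_ ?_)
    · simp [selectReps, port_mem N ha, hmoves, ha.symm]
    · split
      · next h => simp [hmoves, ha, h]
      · next h => simp [hmoves, h]
  obtain ⟨h₁, h₂, h₃⟩ := select_edges hag (fun u v h => h.1) hmem
  refine ⟨fun v => (τ v).sel, τ, rfl, Exec.single fun u v _ => ?_, h₁,
    fun u v h => (h₂ u v).2 (Or.inl h), fun y b hy ha hr => (h₂ y b).2 (Or.inr (Or.inl
      ⟨ha, hy, hr⟩)), ?_⟩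
  · simp only [selectReps]
    split
    · exact hK₁
    · exact Nat.zero_le _
  · -- A pair `(y, b)` with `b` a representative of `y` contributes to the load of `π b`.
    refine (h₃ (N.A.biUnion fun x => (Finset.univ.filter fun b => N.graph.Adj x b ∧ π b = x).biUnion
      fun b => (clients N σ b).image fun y => (y, b)) ?_).trans
      (Nat.add_le_add_left (Nat.mul_le_mul_left 2 (Finset.card_biUnion_le.trans
        (Finset.sum_le_sum fun x _ => Finset.card_biUnion_le.trans ?_))) _)
    · rintro y b ⟨ha, hy, hr⟩
      have hb : b ∉ N.A := (hbip y b ha).1 (hact y hy)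
      have hπ := hh.adj b y hb ha.symm
      simp only [Finset.mem_biUnion, Finset.mem_filter, Finset.mem_univ, true_and,
        Finset.mem_image, Prod.mk.injEq, clients]
      exact ⟨π b, (hbip _ _ hπ.symm).2 hb, b, ⟨hπ.symm, rfl⟩, y, ⟨ha.symm, hy, hr⟩, rfl, rfl⟩
    · rw [load, ← Finset.sum_filter]
      exact Finset.sum_le_sum fun b _ => Finset.card_image_le

theorem exec_selectTaken {σ : V → Register} (hbip : Bipartite N) (hK₁ : 1 ≤ K)
    (hag : Agree N σ) (htaken : ∀ v, (σ v).taken → v ∈ N.A) :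
    ∃ u n : V → ℕ, ∃ l : V → Finset ℕ, ∃ τ : V → Register,
      τ = (fun v => { σ v with up := u v, cnt := n v, sel := l v }) ∧
      Exec N K [findTaken, selectTaken] σ τ ∧ Agree N τ ∧ chosen N σ ≤ chosen N τ ∧
      (∀ b y, N.graph.Adj b y → (σ y).taken → ∃ y', (σ y').taken ∧ (chosen N τ).Adj b y') ∧
      selCount N τ ≤ selCount N σ + 2 * (Finset.univ.filter fun v => v ∉ N.A).card := by
  set σ₁ := round N findTaken σ with hσ₁
  have hcases : ∀ v, (∃ w, v ∉ N.A ∧ N.graph.Adj v w ∧ (σ w).taken ∧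
      σ₁ v = { σ v with up := N.port v w, cnt := 1 }) ∨
      (v ∈ N.A ∨ ∀ y, N.graph.Adj v y → ¬ (σ y).taken) ∧ σ₁ v = { σ v with cnt := 0 } := by
    intro v
    have hrec : ∀ w, N.graph.Adj v w →
        (received N findTaken σ v (N.port v w) ≠ 0 ↔ (σ w).taken) := by
      intro w hw
      rw [received_port N _ _ hw]
      simp [findTaken]
    by_cases h : (N.localInput v).inA = false ∧
        ∃ p ∈ (N.localInput v).ports, received N findTaken σ v p ≠ 0
    · left
      have e : σ₁ v = { σ v with up := h.2.choose, cnt := 1 } := by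
        rw [hσ₁, round]
        exact dif_pos h
      obtain ⟨h₁, h₂⟩ := h.2.choose_spec
      obtain ⟨w, hw, hp⟩ := (mem_ports N).1 h₁
      rw [← hp] at h₂ e
      exact ⟨w, inA_eq_false_iff.1 h.1, hw, (hrec w hw).1 h₂, e⟩
    · right
      refine ⟨?_, ?_⟩
      · by_cases hv : v ∈ N.A
        · exact Or.inl hv
        · exact Or.inr fun y hy ht =>
            h ⟨inA_eq_false_iff.2 hv, _, port_mem N hy, (hrec y hy).2 ht⟩
      · rw [hσ₁, round]
        exact dif_neg h
  have hag₁ : Agree N σ₁ ∧ chosen N σ₁ = chosen N σ ∧ ∀ v, σ₁ v = { σ v with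
      up := (σ₁ v).up, cnt := (σ₁ v).cnt } := by
    have h : ∀ v, σ₁ v = { σ v with up := (σ₁ v).up, cnt := (σ₁ v).cnt } := fun v => by
      rcases hcases v with ⟨w, -, -, -, e⟩ | ⟨-, e⟩ <;> rw [e]
    have hsel : ∀ v, (σ₁ v).sel = (σ v).sel := fun v => by rw [h v]
    refine ⟨fun u v ha => ?_, ?_, h⟩
    · rw [hsel, hsel]; exact hag u v ha
    · ext u v
      simp only [chosen, hsel]
  obtain ⟨hag₁, hch₁, hupd⟩ := hag₁
  set moves : V → V → Prop := fun b y => N.graph.Adj b y ∧ (σ₁ b).cnt ≠ 0 ∧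
    N.port b y = (σ₁ b).up with hmoves
  set τ := round N selectTaken σ₁ with hτ
  have hmem : ∀ v u, N.graph.Adj v u →
      (N.port v u ∈ (τ v).sel ↔ N.port v u ∈ (σ₁ v).sel ∨ moves u v ∨ moves v u) := by
    intro v u ha
    change N.port v u ∈ (σ₁ v).sel ∪ (N.localInput v).ports.filter
        (fun p => received N selectTaken σ₁ v p ≠ 0) ∪
        (if (σ₁ v).cnt ≠ 0 then {(σ₁ v).up} else ∅) ↔ _
    rw [Finset.mem_union, Finset.mem_union, Finset.mem_filter, received_port N _ _ ha, or_assoc]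
    refine or_congr_right (or_congr ?_ ?_)
    · simp [selectTaken, port_mem N ha, hmoves, ha.symm]
    · split
      · next h => simp [hmoves, ha, h]
      · next h => simp [hmoves, h]
  obtain ⟨h₁, h₂, h₃⟩ := select_edges hag₁ (fun u v h => h.1) hmem
  refine ⟨fun v => (σ₁ v).up, fun v => (σ₁ v).cnt, fun v => (τ v).sel, τ, ?_,
    ⟨fun u v _ => ?_, fun u v _ => ?_, rfl⟩, h₁, ?_, ?_, ?_⟩
  · funext v
    change { σ₁ v with sel := (τ v).sel } = _
    rw [hupd v]
  · simp only [findTaken]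
    split
    · exact hK₁
    · exact Nat.zero_le _
  · simp only [selectTaken]
    split
    · exact hK₁
    · exact Nat.zero_le _
  · rw [← hch₁]
    exact fun u v h => (h₂ u v).2 (Or.inl h)
  · intro b y ha hy
    rcases hcases b with ⟨w, -, hw, ht, e⟩ | ⟨hb | hb, -⟩
    · exact ⟨w, ht, (h₂ b w).2 (Or.inr (Or.inl ⟨hw, by rw [e]; simp, by rw [e]⟩))⟩
    · exact absurd (htaken y hy) ((hbip b y ha).1 hb)
    · exact absurd hy (hb y ha)
  · have hc : selCount N σ₁ = selCount N σ := by rw [selCount, hch₁, selCount]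
    rw [← hc]
    refine (h₃ (Finset.univ.filter fun e : V × V => moves e.1 e.2)
      fun u v h => Finset.mem_filter.2 ⟨Finset.mem_univ _, h⟩).trans (Nat.add_le_add_left (Nat.mul_le_mul_left 2 ?_) _)
    refine Finset.card_le_card_of_injOn Prod.fst ?_ ?_
    · intro e he
      simp only [Finset.mem_coe, Finset.mem_filter, Finset.mem_univ, true_and] at he ⊢
      rcases hcases e.1 with ⟨w, hw, -⟩ | ⟨-, e'⟩
      · exact hw
      · exact absurd (by rw [e']) he.2.1
    · rintro ⟨u, v⟩ he ⟨u', v'⟩ he' h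
      simp only [Finset.mem_coe, Finset.mem_filter, Finset.mem_univ, true_and] at he he'
      cases h
      cases port_inj N he.1 he'.1 (he.2.2.trans he'.2.2.symm)
      rfl

end Heads

/-! ### The hierarchy of clusters -/

section Levels

open scoped Classical

/-- The new clusters replace the old ones. -/
def advance : LocalInput → Register → Register :=
  fun _ s => { s with act := s.taken, taken := False, cand := s.next, next := False }

/-- The first level: clusters of depth two around vertices of `A` with load at least `q`. -/
noncomputable def bottomLevel (M q : ℕ) : List Instr :=
  ((List.range' 0 (M / q + 1)).map fun _ => [report, nominate q] ++ explore 0 q).flatten ++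
    [selectReps] ++ [findTaken, selectTaken] ++ [silent advance]

/-- Level `i ≥ 1`: clusters of depth `2 * i` explore their surroundings one after
the other. There are at most `M / q ^ i` of them; the level is skipped if there are none. -/
noncomputable def level (M q i : ℕ) : List Instr :=
  if M / q ^ i = 0 then []
  else ((List.range' 0 (M / q ^ i)).map fun _ => explore (2 * i) (q ^ (i + 1))).flatten ++
    [silent advance]

variable {V : Type*} [Fintype V] (N : Network V)

/-- The set of the vertices with a given property. -/
noncomputable def those (p : V → Prop) : Finset V := Finset.univ.filter p

theorem mem_those {p : V → Prop} {v : V} : v ∈ those p ↔ p v := by simp [those]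

/-- The invariant within a level with participants `R`: the absorbed ones belong to
new clusters of depth `a + 2`, and these have at least `thr` members on average. -/
structure Level (R : V → Prop) (a thr : ℕ) (H : SimpleGraph V) (σ : V → Register) : Prop where
  agree : Agree N σ
  le : H ≤ chosen N σ
  split : ∀ y, R y ↔ (σ y).act ∨ (σ y).taken
  disjoint : ∀ y, (σ y).act → ¬ (σ y).taken
  near : ∀ y, (σ y).taken → ∃ c, (σ c).next ∧ Within (chosen N σ) (a + 2) c y
  many : thr * (those fun c => (σ c).next).card ≤ (those fun y => (σ y).taken).card

variable {N} {K : ℕ}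

section

variable {R : V → Prop} {a thr : ℕ} {H : SimpleGraph V} {σ τ : V → Register}
  {W : Finset V} {Z : V → Finset V}

theorem Level.card_taken (hl : Level N R a thr H σ) (he : Explored N a thr σ τ W Z) :
    (those fun y => (σ y).taken).card + ∑ c ∈ W.filter (fun c => thr ≤ (Z c).card), (Z c).card ≤
      (those fun y => (τ y).taken).card := by
  rw [← Finset.card_biUnion, ← Finset.card_union_of_disjoint]
  · refine Finset.card_le_card fun y hy => ?_
    rw [mem_those, he.taken_iff]
    simp only [Finset.mem_union, mem_those, Finset.mem_biUnion, Finset.mem_filter] at hy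
    exact hy.imp id fun ⟨c, ⟨h₁, h₂⟩, h₃⟩ => ⟨c, h₁, h₃, h₂⟩
  · refine Finset.disjoint_left.2 fun y h₁ h₂ => ?_
    simp only [mem_those, Finset.mem_biUnion, Finset.mem_filter] at h₁ h₂
    obtain ⟨c, ⟨hc, -⟩, hy⟩ := h₂
    exact hl.disjoint y (he.act_of c hc y hy) h₁
  · exact he.disjoint.subset fun c hc => (Finset.mem_filter.1 hc).1

theorem Explored.card_cand (he : Explored N a thr σ τ W Z) :
    (those fun c => (τ c).cand).card + W.card = (those fun c => (σ c).cand).card := by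
  have h₁ : (those fun c => (τ c).cand) = (those fun c => (σ c).cand) \ W := by
    ext c
    rw [Finset.mem_sdiff, mem_those, mem_those, he.cand_iff]
  rw [h₁]
  exact Finset.card_sdiff_add_card_eq_card fun c hc => mem_those.2 (he.cand_of c hc)

theorem Level.explored (hl : Level N R a thr H σ) (he : Explored N a thr σ τ W Z) :
    Level N R a thr H τ := by
  refine ⟨he.agree, hl.le.trans he.le, fun y => ?_, fun y => ?_, fun y hy => ?_, ?_⟩
  · rw [hl.split, he.act_iff, he.taken_iff]
    have : (∃ c ∈ W, y ∈ Z c ∧ thr ≤ (Z c).card) → (σ y).act :=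
      fun ⟨c, hc, h, _⟩ => he.act_of c hc y h
    generalize (∃ c ∈ W, y ∈ Z c ∧ thr ≤ (Z c).card) = P at *
    tauto
  · rw [he.act_iff, he.taken_iff]
    have := hl.disjoint y
    generalize (∃ c ∈ W, y ∈ Z c ∧ thr ≤ (Z c).card) = P at *
    tauto
  · rw [he.taken_iff] at hy
    rcases hy with hy | ⟨c, hc, hy, ht⟩
    · obtain ⟨c, hc, hw⟩ := hl.near y hy
      exact ⟨c, (he.next_iff c).2 (Or.inl hc), hw.mono he.le⟩
    · exact ⟨c, (he.next_iff c).2 (Or.inr ⟨hc, ht⟩), he.near c hc y hy⟩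
  · have h₁ : (those fun c => (τ c).next).card ≤
        (those fun c => (σ c).next).card + (W.filter fun c => thr ≤ (Z c).card).card := by
      refine le_trans (Finset.card_le_card fun c hc => ?_) (Finset.card_union_le _ _)
      rw [mem_those, he.next_iff] at hc
      simpa only [Finset.mem_union, mem_those, Finset.mem_filter] using hc
    have h₂ : (W.filter fun c => thr ≤ (Z c).card).card * thr ≤
        ∑ c ∈ W.filter (fun c => thr ≤ (Z c).card), (Z c).card :=
      Finset.card_nsmul_le_sum _ _ _ fun c hc => (Finset.mem_filter.1 hc).2
    have h₃ := hl.card_taken he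
    have h₄ := hl.many
    nlinarith

/-- Edges selected by winners that build a new cluster are charged to the absorbed
vertices, and each other winner selects few edges. -/
theorem Level.count (hl : Level N R a thr H σ) (he : Explored N a thr σ τ W Z) :
    selCount N τ + 4 * (those fun y => (σ y).taken).card ≤
      selCount N σ + 4 * (those fun y => (τ y).taken).card +
        4 * (thr * (W.filter fun c => ¬ thr ≤ (Z c).card).card) := by
  have h₁ := hl.card_taken he
  have h₂ := he.count
  rw [← Finset.sum_filter_add_sum_filter_not W (fun c => thr ≤ (Z c).card)] at h₂
  have h₃ : ∑ c ∈ W.filter (fun c => ¬ thr ≤ (Z c).card), (Z c).card ≤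
      (W.filter fun c => ¬ thr ≤ (Z c).card).card * thr :=
    Finset.sum_le_card_nsmul _ _ _ fun c hc => (not_le.1 (Finset.mem_filter.1 hc).2).le
  nlinarith

end

variable (N)

/-- The invariant between the levels: the active vertices belong to clusters of depth `2 * i`,
which have at least `q ^ i` members on average. Of the vertices in `R`, any two that have a common
neighbour are both active, or their distance is at most `r`. -/
structure Clustered (R : V → Prop) (q r c₀ i : ℕ) (σ : V → Register) : Prop where
  agree : Agree N σ
  taken : ∀ v, ¬ (σ v).taken
  next : ∀ v, ¬ (σ v).next
  sub : ∀ v, (σ v).act → v ∈ N.A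
  near : ∀ y, (σ y).act → ∃ c, (σ c).cand ∧ Within (chosen N σ) (2 * i) c y
  many : q ^ i * (those fun c => (σ c).cand).card ≤ (those fun y => (σ y).act).card
  cover : ∀ y y' b, R y → R y' → N.graph.Adj b y → N.graph.Adj b y' →
    (σ y).act ∧ (σ y').act ∨ Within (chosen N σ) r y y'
  count : selCount N σ ≤ c₀ + i * (4 * (N.A.card * (q + 1)))

variable {N}

theorem Clustered.card_cand {R : V → Prop} {q r c₀ i : ℕ} {σ : V → Register}
    (hc : Clustered N R q r c₀ i σ) : q ^ i * (those fun c => (σ c).cand).card ≤ N.A.card :=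
  hc.many.trans (Finset.card_le_card fun y hy => hc.sub y ((mem_those (v := y)).1 hy))

theorem Clustered.not_act {R : V → Prop} {q r c₀ i : ℕ} {σ : V → Register}
    (hc : Clustered N R q r c₀ i σ) (h : N.A.card < q ^ i) :
    (∀ v, ¬ (σ v).cand) ∧ ∀ v, ¬ (σ v).act := by
  have h₁ := hc.card_cand
  have h₂ : (those fun c => (σ c).cand).card = 0 := by
    by_contra h₀
    have : q ^ i * 1 ≤ q ^ i * (those fun c => (σ c).cand).card :=
      Nat.mul_le_mul_left _ (Nat.one_le_iff_ne_zero.2 h₀)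
    omega
  have h₃ : ∀ v, ¬ (σ v).cand := fun v hv => by
    rw [Finset.card_eq_zero] at h₂
    have : v ∈ those fun c => (σ c).cand := mem_those.2 hv
    rw [h₂] at this
    exact Finset.notMem_empty v this
  refine ⟨h₃, fun v hv => ?_⟩
  obtain ⟨c, hcand, -⟩ := hc.near v hv
  exact h₃ c hcand

theorem exec_level {R : V → Prop} {M q r c₀ i : ℕ} {σ : V → Register} (hK₁ : 1 ≤ K)
    (hK : Fintype.card V ≤ K) (hid : ∀ v, N.ident v + 1 ≤ K) (hM : N.A.card ≤ M) (hq : 0 < q)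
    (hr : 4 * i + 2 ≤ r) (hc : Clustered N R q r c₀ i σ) :
    ∃ τ, Exec N K (level M q i) σ τ ∧ chosen N σ ≤ chosen N τ ∧ Clustered N R q r c₀ (i + 1) τ := by
  have hqi : 0 < q ^ i := Nat.pow_pos hq
  rw [level]
  split
  · next h0 =>
    have hlt : M < q ^ i := by
      rcases Nat.div_eq_zero_iff.1 h0 with h | h <;> omega
    obtain ⟨h₁, h₂⟩ := hc.not_act (hM.trans_lt hlt)
    refine ⟨σ, rfl, le_rfl, hc.agree, hc.taken, hc.next, hc.sub, fun y hy => absurd hy (h₂ y), ?_,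
      hc.cover, hc.count.trans (Nat.add_le_add_left (Nat.mul_le_mul_right _ i.le_succ) _)⟩
    have : (those fun c => (σ c).cand) = ∅ :=
      Finset.eq_empty_of_forall_notMem fun c hc => h₁ c ((mem_those (v := c)).1 hc)
    rw [this]
    simp
  · set thr := q ^ (i + 1) with hthr
    have hcand : (those fun c => (σ c).cand).card ≤ M / q ^ i := by
      rw [Nat.le_div_iff_mul_le hqi, mul_comm]
      exact hc.card_cand.trans hM
    have hnone : ∀ p : V → Prop, (∀ v, ¬ p v) → (those p).card = 0 := fun p hp =>
      Finset.card_eq_zero.2 (Finset.eq_empty_of_forall_notMem fun v hv => hp v (mem_those.1 hv))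
    have key := Exec.flatten (N := N) (K := K) (σ := σ)
      (ls := fun _ => explore (2 * i) thr)
      (fun j τ => Level N (fun y => (σ y).act) (2 * i) thr (chosen N σ) τ ∧
        ((those fun c => (τ c).cand).card + j ≤ M / q ^ i ∨
          (those fun c => (τ c).cand).card = 0) ∧
        (∀ c, (σ c).cand → (τ c).cand ∨ ∀ x y, Within (chosen N σ) (2 * i) c x →
          Within N.graph 2 x y → (τ y).act → Within (chosen N τ) (2 * i + 2) c y) ∧
        selCount N τ + 4 * (thr * (those fun c => (τ c).cand).card) ≤
          selCount N σ + 4 * (those fun y => (τ y).taken).card +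
            4 * (thr * (those fun c => (σ c).cand).card)) 0 (M / q ^ i)
    refine Exists.elim (key ?step ?start) ?finish
    case start =>
      refine ⟨⟨hc.agree, le_rfl, fun y => ?_, fun y _ => hc.taken y,
        fun y hy => absurd hy (hc.taken y), ?_⟩, Or.inl hcand, fun c h => Or.inl h, by omega⟩
      · exact ⟨Or.inl, fun h => h.resolve_right (hc.taken y)⟩
      · rw [hnone _ hc.next]
        simp
    case step =>
      rintro j τ - - ⟨hl, hj, hproc, hcnt⟩
      obtain ⟨W, Z, υ, hx, he⟩ := exec_explore (2 * i) thr hK₁ hK hid hl.agree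
      refine ⟨υ, hx, hl.explored he, ?_, ?_, ?_⟩
      · have h₁ := he.card_cand
        by_cases h₀ : (those fun c => (τ c).cand).card = 0
        · exact Or.inr (by omega)
        · have h₂ : W.Nonempty := by
            obtain ⟨c, hc⟩ := Finset.card_ne_zero.1 h₀
            exact he.nonempty ⟨c, (mem_those (v := c)).1 hc⟩
          have h₃ := h₂.card_pos
          exact Or.inl (by omega)
      · intro c hcσ
        by_cases hcW : c ∈ W
        · right
          intro x y hx hy hact
          have hact' := (he.act_iff y).1 hact
          exact he.near c hcW y (he.cover c hcW x y (hx.mono hl.le) hy hact'.1)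
        · refine (hproc c hcσ).imp (fun h => (he.cand_iff c).2 ⟨h, hcW⟩) fun h x y hx hy hact => ?_
          exact (h x y hx hy ((he.act_iff y).1 hact).1).mono he.le
      · have h₁ := hl.count he
        have h₂ := he.card_cand
        have h₃ : (W.filter fun c => ¬ thr ≤ (Z c).card).card ≤ W.card := Finset.card_filter_le _ _
        nlinarith
    case finish =>
      rintro τ ⟨hx, hl, hj, hproc, hcnt⟩
      have hcard0 : (those fun c => (τ c).cand).card = 0 := by omega
      have hproc : ∀ c, (σ c).cand → ∀ x y, Within (chosen N σ) (2 * i) c x →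
          Within N.graph 2 x y → (τ y).act → Within (chosen N τ) (2 * i + 2) c y := by
        intro c hcσ
        refine (hproc c hcσ).resolve_left fun h => ?_
        rw [Finset.card_eq_zero] at hcard0
        have : c ∈ those fun c => (τ c).cand := mem_those.2 h
        rw [hcard0] at this
        exact Finset.notMem_empty c this
      -- `y` has been left over in this level, in which `y'` took part
      have hleft : ∀ y y' b, (τ y).act → (σ y').act → N.graph.Adj b y → N.graph.Adj b y' →
          Within (chosen N τ) r y' y := by
        intro y y' b hy hy' hby hby'
        obtain ⟨c, hcσ, hw⟩ := hc.near y' hy'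
        have h₁ : Within N.graph 2 y' y :=
          (Within.of_adj hby'.symm).trans (Within.of_adj hby)
        exact ((hw.mono hl.le).symm.trans (hproc c hcσ y' y hw h₁ hy)).mono_right (by omega)
      refine ⟨fun v => advance (N.localInput v) (τ v), hx.append (Exec.silent advance τ), hl.le,
        hl.agree, fun v => id, fun v => id, ?_, ?_, ?_, ?_, ?_⟩
      · intro v hv
        exact hc.sub v ((hl.split v).2 (Or.inr hv))
      · intro y hy
        obtain ⟨c, h₁, h₂⟩ := hl.near y hy
        exact ⟨c, h₁, h₂⟩
      · exact hl.many
      · intro y y' b hy hy' hb hb'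
        rcases hc.cover y y' b hy hy' hb hb' with ⟨h₁, h₂⟩ | h
        · rcases (hl.split y).1 h₁ with h₃ | h₃
          · exact Or.inr (hleft y y' b h₃ h₂ hb hb').symm
          · rcases (hl.split y').1 h₂ with h₄ | h₄
            · exact Or.inr (hleft y' y b h₄ h₁ hb' hb)
            · exact Or.inl ⟨h₃, h₄⟩
        · exact Or.inr (h.mono hl.le)
      · change selCount N τ ≤ _
        have h₁ : (those fun y => (τ y).taken).card ≤ N.A.card :=
          Finset.card_le_card fun y hy =>
            hc.sub y ((hl.split y).2 (Or.inr ((mem_those (v := y)).1 hy)))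
        have h₂ := hc.count
        have h₃ := Nat.mul_le_mul_left q hc.card_cand
        have h₄ : thr * (those fun c => (σ c).cand).card =
            q * (q ^ i * (those fun c => (σ c).cand).card) := by
          rw [hthr, pow_succ]; ring
        rw [h₄, hcard0] at hcnt
        nlinarith

/-- The outcome of the first level. A vertex `y` of `A` is in `R` if it belongs to
a cluster, and otherwise the edges at it are already spanned. -/
theorem exec_bottomLevel {π : V → V} {M q r c₀ : ℕ} {σ : V → Register} (hbip : Bipartite N)
    (hK₁ : 1 ≤ K) (hK : Fintype.card V ≤ K) (hid : ∀ v, N.ident v + 1 ≤ K) (hM : N.A.card ≤ M)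
    (hq : 0 < q) (hh : Heads N π σ) (hag : Agree N σ)
    (hπ : ∀ b y, b ∉ N.A → N.graph.Adj b y → (chosen N σ).Adj b (π b))
    (hcount : selCount N σ ≤ c₀)
    (hσ : ∀ v, ((σ v).act ↔ v ∈ N.A) ∧ ¬ (σ v).taken ∧ ¬ (σ v).next) :
    ∃ τ, ∃ R : V → Prop, Exec N K (bottomLevel M q) σ τ ∧
      Clustered N R q r (c₀ + 2 * (Finset.univ.filter fun v => v ∉ N.A).card) 1 τ ∧
      ∀ y b, y ∈ N.A → N.graph.Adj y b → Within (chosen N τ) 3 y b ∨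
        R y ∧ ∃ y', R y' ∧ (chosen N τ).Adj b y' := by
  have hnone : ∀ p : V → Prop, (∀ v, ¬ p v) → (those p).card = 0 := fun p hp =>
    Finset.card_eq_zero.2 (Finset.eq_empty_of_forall_notMem fun v hv => hp v (mem_those.1 hv))
  have key := Exec.flatten (N := N) (K := K) (σ := σ)
    (ls := fun _ => [report, nominate q] ++ explore 0 q)
    (fun j τ => Level N (· ∈ N.A) 0 q (chosen N σ) τ ∧ Heads N π τ ∧
      ((∀ x ∈ N.A, load N π τ x < q) ∨ q * j ≤ (those fun y => (τ y).taken).card) ∧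
      selCount N τ ≤ selCount N σ + 4 * (those fun y => (τ y).taken).card) 0 (M / q + 1)
  refine Exists.elim (key ?step ?start) ?finish
  case start =>
    refine ⟨⟨hag, le_rfl, fun y => ?_, fun y _ => (hσ y).2.1, fun y hy => absurd hy (hσ y).2.1, ?_⟩,
      hh, Or.inr (by simp), Nat.le_add_right _ _⟩
    · rw [← (hσ y).1]
      exact ⟨Or.inl, fun h => h.resolve_right (hσ y).2.1⟩
    · rw [hnone _ fun v => (hσ v).2.2]
      simp
  case step =>
    rintro j τ - - ⟨hl, hh, hj, hcnt⟩
    obtain ⟨n, d, hx₁, hd⟩ := exec_tally (N := N) hbip hK₁ hK hh q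
    set τ₁ : V → Register := fun v => { τ v with cnt := n v, cand := d v } with hτ₁
    have hl₁ : Level N (· ∈ N.A) 0 q (chosen N σ) τ₁ :=
      ⟨hl.agree, hl.le, hl.split, hl.disjoint, hl.near, hl.many⟩
    obtain ⟨W, Z, υ, hx₂, he⟩ := exec_explore 0 q hK₁ hK hid hl₁.agree
    have hact : ∀ v, (τ₁ v).act → v ∈ N.A := fun v hv => (hl₁.split v).2 (Or.inl hv)
    have hh₁ : Heads N π τ₁ := ⟨hh.adj, hh.up_eq, hh.exists_rep, hh.unique_rep⟩
    -- Every winner has a large load, hence builds a new cluster.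
    have hbig : ∀ c ∈ W, q ≤ (Z c).card := fun c hc =>
      ((hd c).1 (he.cand_of c hc)).2.trans (load_le hh₁ hact fun y hy hw =>
        he.cover c hc c y (Within.refl _ _) hw hy)
    refine ⟨υ, hx₁.append hx₂, hl₁.explored he, ⟨hh.adj, ?_, ?_, ?_⟩, ?_, ?_⟩
    · intro b y
      rw [(he.frame b).2.2]
      exact hh.up_eq b y
    · intro y b
      rw [(he.frame y).1]
      exact hh.exists_rep y b
    · intro y b b'
      rw [(he.frame y).1]
      exact hh.unique_rep y b b'
    · by_cases hW : ∃ c, d c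
      · obtain ⟨c, hc⟩ := he.nonempty hW
        rcases hj with hj | hj
        · have h₁ := (hd c).1 (he.cand_of c hc)
          exact absurd h₁.2 (not_le.2 (hj c h₁.1))
        · right
          have h₁ := hl₁.card_taken he
          have h₂ := hbig c hc
          have h₃ := Finset.single_le_sum (f := fun c => (Z c).card) (fun _ _ => Nat.zero_le _)
            (Finset.mem_filter.2 ⟨hc, h₂⟩ : c ∈ W.filter fun c => q ≤ (Z c).card)
          have h₄ : (those fun y => (τ₁ y).taken).card = (those fun y => (τ y).taken).card := rfl
          rw [mul_add, mul_one]
          omega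
      · left
        intro x hx
        refine (load_mono (σ := τ) (fun v => (he.frame v).1)
          (fun v hv => ((he.act_iff v).1 hv).1) x).trans_lt ?_
        by_contra h
        exact hW ⟨x, (hd x).2 ⟨hx, not_lt.1 h⟩⟩
    · have h₁ := hl₁.count he
      rw [Finset.filter_false_of_mem fun c hc => not_not.2 (hbig c hc)] at h₁
      have h₂ : (those fun y => (τ₁ y).taken).card = (those fun y => (τ y).taken).card := rfl
      have h₃ : selCount N τ₁ = selCount N τ := rfl
      rw [Finset.card_empty] at h₁
      omega
  case finish =>
    rintro τ ⟨hx, hl, hh, hj, hcnt⟩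
    have hA : (those fun y => (τ y).taken).card ≤ N.A.card :=
      Finset.card_le_card fun y hy => (hl.split y).2 (Or.inr ((mem_those (v := y)).1 hy))
    have hload : ∀ x ∈ N.A, load N π τ x < q := by
      refine hj.resolve_right fun h => ?_
      rw [Nat.zero_add] at h
      have := Nat.lt_mul_div_succ M hq
      omega
    have hact : ∀ v, (τ v).act → v ∈ N.A := fun v hv => (hl.split v).2 (Or.inl hv)
    obtain ⟨l₂, τ₂, e₂, hx₂, hag₂, hle₂, hrep, hcnt₂⟩ :=
      exec_selectReps hbip hK₁ hh hl.agree hact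
    have htaken₂ : ∀ v, (τ₂ v).taken ↔ (τ v).taken := fun v => by rw [e₂]
    obtain ⟨u, n, l₃, τ₃, e₃, hx₃, hag₃, hle₃, hsec, hcnt₃⟩ := exec_selectTaken hbip hK₁ hag₂
      fun v hv => (hl.split v).2 (Or.inr ((htaken₂ v).1 hv))
    have htaken₃ : ∀ v, (τ₃ v).taken = (τ v).taken := fun v => by rw [e₃, e₂]
    have hnext₃ : ∀ v, (τ₃ v).next = (τ v).next := fun v => by rw [e₃, e₂]
    set υ : V → Register := fun v => advance (N.localInput v) (τ₃ v) with hυ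
    have hactυ : ∀ v, (υ v).act ↔ (τ v).taken := fun v => by rw [← htaken₃]; rfl
    have hcandυ : ∀ v, (υ v).cand ↔ (τ v).next := fun v => by rw [← hnext₃]; rfl
    have hchυ : chosen N υ = chosen N τ₃ := rfl
    have hle : chosen N τ ≤ chosen N υ := hle₂.trans hle₃
    refine ⟨υ, fun y => (τ y).taken,
      ((hx.append hx₂).append hx₃).append (Exec.silent advance τ₃),
      ⟨hag₃, fun v => id, fun v => id, ?_, ?_, ?_, ?_, ?_⟩, ?_⟩
    · intro v hv
      exact (hl.split v).2 (Or.inr ((hactυ v).1 hv))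
    · intro y hy
      obtain ⟨c, h₁, h₂⟩ := hl.near y ((hactυ y).1 hy)
      exact ⟨c, (hcandυ c).2 h₁, h₂.mono hle⟩
    · simp only [hactυ, hcandυ, pow_one]
      exact hl.many
    · intro y y' b hy hy' _ _
      exact Or.inl ⟨(hactυ y).2 hy, (hactυ y').2 hy'⟩
    · change selCount N τ₃ ≤ _
      have h₁ : ∑ x ∈ N.A, load N π τ x ≤ N.A.card * q :=
        Finset.sum_le_card_nsmul _ _ _ fun x hx => (hload x hx).le
      nlinarith
    · intro y b hy hb
      have hbA : b ∉ N.A := (hbip y b hb).1 hy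
      rcases (hl.split y).1 hy with h | h
      · -- from `y` through a representative to the head of `b`, and on to `b`
        left
        obtain ⟨b', hb', hπ', hr⟩ := hh.exists_rep y b hy hb
        have hb'A : b' ∉ N.A := (hbip y b' hb').1 hy
        have h₁ : (chosen N υ).Adj y b' := hle₃ (hrep y b' h hb' hr)
        have h₂ : (chosen N υ).Adj b' (π b) := by
          rw [← hπ']
          exact hle (hl.le (hπ b' y hb'A hb'.symm))
        have h₃ : (chosen N υ).Adj b (π b) := hle (hl.le (hπ b y hbA hb.symm))
        exact ((Within.of_adj h₁).trans (Within.of_adj h₂)).trans (Within.of_adj h₃.symm)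
      · right
        obtain ⟨y', h₁, h₂⟩ := hsec b y hb.symm ((htaken₂ y).2 h)
        exact ⟨h, y', (htaken₂ y').1 h₁, h₂⟩

end Levels

/-! ### The spanner algorithm -/

section Program

open scoped Classical

/-- The growth factor of the clusters from level to level: for even `k`, the least `q` with
`M < q ^ (k / 2)`. -/
noncomputable def growth (k M : ℕ) : ℕ := ⌊(M : ℝ) ^ (2 / (k : ℝ))⌋₊ + 1

/-- The program of all vertices; `M` is an upper bound on the size of `A`. -/
noncomputable def program (k M : ℕ) : List Instr :=
  if M = 0 then []
  else [chooseHead, chooseReps] ++ bottomLevel M (growth k M) ++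
    ((List.range' 1 (k / 2 - 1)).map (level M (growth k M))).flatten

theorem growth_le {k M : ℕ} (hM : M ≠ 0) : (growth k M : ℝ) ≤ 2 * (M : ℝ) ^ (2 / (k : ℝ)) := by
  have h₁ : (1 : ℝ) ≤ (M : ℝ) ^ (2 / (k : ℝ)) :=
    Real.one_le_rpow (by exact_mod_cast Nat.one_le_iff_ne_zero.2 hM) (by positivity)
  have h₂ := Nat.floor_le (zero_le_one.trans h₁)
  rw [growth]
  push_cast
  linarith

theorem le_growth (k M : ℕ) : (M : ℝ) ^ (2 / (k : ℝ)) ≤ growth k M := by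
  rw [growth]
  push_cast
  exact (Nat.lt_floor_add_one _).le

theorem two_le_growth {k M : ℕ} (hM : M ≠ 0) : 2 ≤ growth k M := by
  have h₁ : (1 : ℝ) ≤ (M : ℝ) ^ (2 / (k : ℝ)) :=
    Real.one_le_rpow (by exact_mod_cast Nat.one_le_iff_ne_zero.2 hM) (by positivity)
  have : 1 ≤ ⌊(M : ℝ) ^ (2 / (k : ℝ))⌋₊ := Nat.le_floor (by simpa using h₁)
  rw [growth]
  omega

theorem lt_growth_pow {k M : ℕ} (hk : Even k) (hk4 : 4 ≤ k) : M < growth k M ^ (k / 2) := by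
  obtain ⟨m, rfl⟩ := hk
  have hm : (m : ℝ) ≠ 0 := by
    have : m ≠ 0 := by omega
    exact_mod_cast this
  rw [show (m + m) / 2 = m by omega]
  have h₁ : (M : ℝ) ^ (2 / ((m + m : ℕ) : ℝ)) < growth (m + m) M := by
    rw [growth]
    push_cast
    exact Nat.lt_floor_add_one _
  have h₂ := pow_lt_pow_left₀ h₁ (by positivity) (n := m) (by omega)
  rw [← Real.rpow_natCast, ← Real.rpow_mul (by positivity)] at h₂
  have h₃ : 2 / ((m + m : ℕ) : ℝ) * (m : ℝ) = 1 := by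
    push_cast
    field_simp
    norm_num
  rw [h₃, Real.rpow_one] at h₂
  exact_mod_cast h₂

theorem length_level_le (M q i : ℕ) : (level M q i).length ≤ M / q ^ i * (10 * i + 16) := by
  rw [level]
  split
  · exact Nat.zero_le _
  · next h =>
    have h₁ : 1 ≤ M / q ^ i := Nat.one_le_iff_ne_zero.2 h
    simp only [List.length_append, List.length_flatten, List.map_const', List.map_replicate,
      length_explore, List.length_range', List.sum_replicate, smul_eq_mul,
      List.length_singleton]
    nlinarith

theorem length_bottomLevel (M q : ℕ) : (bottomLevel M q).length = (M / q + 1) * 17 + 4 := by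
  simp only [bottomLevel, List.length_append, List.length_flatten, List.map_const',
    List.map_replicate, length_explore, List.length_range', List.sum_replicate, smul_eq_mul,
    List.length_cons, List.length_nil]

/-- The number of rounds is dominated by the first levels, since the number of clusters drops
by a factor of at least two from level to level. -/
theorem length_levels_le {M q : ℕ} (hq : 2 ≤ q) (m : ℕ) :
    (((List.range' 1 m).map (level M q)).flatten.length : ℝ) ≤
      (M / q : ℝ) * (72 - (20 * m + 72) / 2 ^ m) := by
  have hq0 : (2 : ℝ) ≤ q := by exact_mod_cast hq
  induction m with
  | zero => simp
  | succ m ih =>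
    rw [List.range'_1_concat, List.map_append, List.flatten_append, List.length_append]
    have h₁ : ((level M q (1 + m)).length : ℝ) ≤ (M / q : ℝ) * (1 / 2 ^ m) * (10 * m + 26) := by
      have h₂ : ((level M q (1 + m)).length : ℝ) ≤
          ((M / q ^ (1 + m) : ℕ) : ℝ) * (10 * m + 26) := by
        have := length_level_le M q (1 + m)
        rw [show 10 * (1 + m) + 16 = 10 * m + 26 by ring] at this
        exact_mod_cast this
      refine h₂.trans (mul_le_mul_of_nonneg_right ?_ (by positivity))
      refine Nat.cast_div_le.trans ?_
      push_cast
      rw [pow_add, pow_one, ← div_div, div_eq_mul_one_div ((M : ℝ) / q)]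
      refine mul_le_mul_of_nonneg_left ?_ (by positivity)
      exact one_div_le_one_div_of_le (by positivity) (pow_le_pow_left₀ (by norm_num) hq0 m)
    have h₂ : (M / q : ℝ) * (72 - (20 * ((m + 1 : ℕ) : ℝ) + 72) / 2 ^ (m + 1)) =
        (M / q : ℝ) * (72 - (20 * m + 72) / 2 ^ m) +
          (M / q : ℝ) * (1 / 2 ^ m) * (10 * m + 26) := by
      push_cast
      field_simp
      ring
    rw [h₂]
    simp only [List.map_cons, List.map_nil, List.flatten_cons, List.flatten_nil, List.append_nil]
    push_cast
    exact add_le_add ih h₁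

theorem length_program_le {k M : ℕ} (hk4 : 4 ≤ k) :
    ((program k M).length : ℝ) ≤ 135 * (M : ℝ) ^ (1 - 2 / (k : ℝ)) := by
  rw [program]
  split
  · simp only [List.length_nil, Nat.cast_zero]
    positivity
  · next hM =>
    have hM' : (1 : ℝ) ≤ M := by exact_mod_cast Nat.one_le_iff_ne_zero.2 hM
    have hk : (4 : ℝ) ≤ k := by exact_mod_cast hk4
    have hexp : 2 / (k : ℝ) ≤ 1 := by
      rw [div_le_one (by linarith)]
      linarith
    set q := growth k M with hq
    have hq2 : 2 ≤ q := two_le_growth hM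
    have hq0 : (0 : ℝ) < q := by exact_mod_cast (by omega : 0 < q)
    set X : ℝ := M / q with hX
    set P : ℝ := (M : ℝ) ^ (2 / (k : ℝ)) with hP
    have hP0 : 0 < P := by positivity
    have hpow : (M : ℝ) ^ (1 - 2 / (k : ℝ)) = M / P := by
      rw [Real.rpow_sub (by linarith), Real.rpow_one]
    have h₁ : X ≤ (M : ℝ) ^ (1 - 2 / (k : ℝ)) := by
      rw [hpow]
      exact div_le_div_of_nonneg_left (by linarith) hP0 (le_growth k M)
    have h₂ : 1 ≤ 2 * X := by
      have h₃ : (1 : ℝ) ≤ M / P := by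
        rw [← hpow]
        exact Real.one_le_rpow hM' (by linarith)
      have h₄ : M / (2 * P) ≤ X :=
        div_le_div_of_nonneg_left (by linarith) hq0 (growth_le hM)
      have h₅ : M / (2 * P) = (M / P) / 2 := by
        field_simp
      linarith
    have h₃ := length_levels_le (M := M) hq2 (k / 2 - 1)
    have h₄ : X * (72 - (20 * ((k / 2 - 1 : ℕ) : ℝ) + 72) / 2 ^ (k / 2 - 1)) ≤ X * 72 := by
      refine mul_le_mul_of_nonneg_left ?_ (by positivity)
      have : (0 : ℝ) ≤ (20 * ((k / 2 - 1 : ℕ) : ℝ) + 72) / 2 ^ (k / 2 - 1) := by positivity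
      linarith
    have h₅ : ((M / q : ℕ) : ℝ) ≤ X := Nat.cast_div_le
    rw [List.length_append, List.length_append, length_bottomLevel]
    push_cast
    simp only [List.length_cons, List.length_nil]
    push_cast
    linarith

variable {V : Type*} [Fintype V] {N : Network V} {K : ℕ}

theorem exec_program {k M : ℕ} (hk : Even k) (hk4 : 4 ≤ k) (hbip : Bipartite N)
    (hM : N.A.card ≤ M) (hK₁ : M ≠ 0 → 1 ≤ K) (hK : Fintype.card V ≤ K)
    (hid : ∀ v, N.ident v + 1 ≤ K) :
    ∃ τ, Exec N K (program k M) (fun v => initial (N.localInput v)) τ ∧ Agree N τ ∧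
      (∀ y b, y ∈ N.A → N.graph.Adj y b → Within (chosen N τ) (2 * k - 1) y b) ∧
      selCount N τ ≤ 4 * (Finset.univ.filter fun v => v ∉ N.A).card +
        k / 2 * (4 * (N.A.card * (growth k M + 1))) := by
  rw [program]
  split
  · next h0 =>
    have hA : N.A = ∅ := Finset.card_eq_zero.1 (by omega)
    refine ⟨_, rfl, fun u v _ h => absurd h (Finset.notMem_empty _), fun y b hy => ?_, ?_⟩
    · rw [hA] at hy
      exact absurd hy (Finset.notMem_empty _)
    · have : selCount N (fun v => initial (N.localInput v)) = 0 := by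
        refine Finset.card_eq_zero.2 (Finset.eq_empty_of_forall_notMem fun e he => ?_)
        exact absurd (Finset.mem_filter.1 he).2.2.1 (Finset.notMem_empty _)
      rw [this]
      exact Nat.zero_le _
  · next hM0 =>
    have hK₁ := hK₁ hM0
    set q := growth k M with hq
    have hq2 : 2 ≤ q := two_le_growth hM0
    obtain ⟨π, σ, hx₁, hh, hag, hπ, hc₁, hσ⟩ := exec_setup hbip hid
    obtain ⟨τ, R, hx₂, hcl, hbase⟩ := exec_bottomLevel (M := M) (q := q) (r := 2 * k - 2) hbip hK₁
      hK hid hM (by omega) hh hag hπ hc₁ hσ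
    have key := Exec.flatten (N := N) (K := K) (σ := τ) (ls := level M q)
      (fun i υ => chosen N τ ≤ chosen N υ ∧ Clustered N R q (2 * k - 2)
        (2 * (Finset.univ.filter fun v => v ∉ N.A).card +
          2 * (Finset.univ.filter fun v => v ∉ N.A).card) i υ) 1 (k / 2 - 1)
    refine Exists.elim (key ?step ⟨le_rfl, hcl⟩) ?finish
    case step =>
      rintro i υ hi hik ⟨hle, hcl⟩
      obtain ⟨φ, hx, hle', hcl'⟩ := exec_level hK₁ hK hid hM (by omega) (by omega) hcl
      exact ⟨φ, hx, hle.trans hle', hcl'⟩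
    case finish =>
      rintro υ ⟨hx₃, hle, hcl⟩
      rw [show 1 + (k / 2 - 1) = k / 2 by omega] at hcl
      have hnot := (hcl.not_act (hM.trans_lt (lt_growth_pow hk hk4))).2
      refine ⟨υ, (hx₁.append hx₂).append hx₃, hcl.agree, fun y b hy hb => ?_, ?_⟩
      · rcases hbase y b hy hb with h | ⟨hR, y', hR', hb'⟩
        · exact (h.mono hle).mono_right (by omega)
        · rcases hcl.cover y y' b hR hR' hb.symm hb'.1 with ⟨h, -⟩ | h
          · exact absurd h (hnot y)
          · exact (h.trans (Within.of_adj (hle hb').symm)).mono_right (by omega)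
      · have := hcl.count
        omega

/-- It suffices to check the stretch on edges. -/
theorem isSpanner_of_within {V : Type*} {G H : SimpleGraph V} {r : ℕ} (hr : r ≠ 0) (hle : H ≤ G)
    (h : ∀ u v, G.Adj u v → Within H r u v) : IsSpanner G H r := by
  refine ⟨hle, fun u v => ?_⟩
  by_cases htop : G.edist u v = ⊤
  · rw [htop, ENat.mul_top (by exact_mod_cast hr)]
    exact le_top
  · obtain ⟨p, hp⟩ := SimpleGraph.exists_walk_of_edist_ne_top htop
    rw [← hp]
    have : Within H (r * p.length) u v := by
      clear hp htop
      induction p with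
      | nil => exact Within.refl _ _
      | cons ha p ih =>
        refine ((h _ _ ha).trans ih).mono_right (le_of_eq ?_)
        rw [SimpleGraph.Walk.length_cons]
        ring
    exact_mod_cast this.edist_le

theorem ncard_edgeSet_chosen_le (σ : V → Register) :
    (chosen N σ).edgeSet.ncard ≤ selCount N σ := by
  have : (chosen N σ).edgeSet ⊆ ((Finset.univ.filter fun e : V × V =>
      (chosen N σ).Adj e.1 e.2).image fun e => s(e.1, e.2) : Finset (Sym2 V)) := by
    intro e he
    induction e with
    | _ u v =>
      simp only [Finset.coe_image, Set.mem_image, Finset.mem_coe, Finset.mem_filter,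
        Finset.mem_univ, true_and]
      exact ⟨(u, v), he, rfl⟩
  refine (Set.ncard_le_ncard this (Finset.finite_toSet _)).trans ?_
  rw [Set.ncard_coe_finset]
  exact Finset.card_image_le

/-- The bound on the messages has logarithmically many bits. -/
theorem size_cap_le {c d n m : ℕ} (hn : 2 ≤ n) (hm : m ≤ c * (c * n)) :
    (m ^ d + m).size ≤ ((c ^ 2 + 2) * (d + 1) + 2) * Nat.log 2 n := by
  set L := Nat.log 2 n with hL
  have hL1 : 1 ≤ L := Nat.log_pos (by norm_num) hn
  set s := (c ^ 2 + 2) * L with hs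
  have hms : m ≤ 2 ^ s := by
    have h₁ : c ^ 2 ≤ 2 ^ (c ^ 2 * L) :=
      (Nat.lt_two_pow_self).le.trans
        (Nat.pow_le_pow_right (by norm_num) (Nat.le_mul_of_pos_right _ hL1))
    have h₂ : n ≤ 2 ^ (2 * L) :=
      (Nat.lt_pow_succ_log_self (by norm_num) n).le.trans
        (Nat.pow_le_pow_right (by norm_num) (by omega))
    calc m ≤ c ^ 2 * n := by rw [pow_two, mul_assoc]; exact hm
      _ ≤ 2 ^ (c ^ 2 * L) * 2 ^ (2 * L) := Nat.mul_le_mul h₁ h₂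
      _ = 2 ^ s := by rw [← pow_add, hs]; ring_nf
  rw [Nat.size_le]
  have h₁ : m ^ d ≤ 2 ^ (s * (d + 1)) :=
    (Nat.pow_le_pow_left hms d).trans (by
      rw [← pow_mul]
      exact Nat.pow_le_pow_right (by norm_num) (Nat.mul_le_mul_left _ d.le_succ))
  have h₂ : m ≤ 2 ^ (s * (d + 1)) :=
    hms.trans (Nat.pow_le_pow_right (by norm_num) (Nat.le_mul_of_pos_right _ d.succ_pos))
  calc m ^ d + m ≤ 2 ^ (s * (d + 1)) + 2 ^ (s * (d + 1)) := Nat.add_le_add h₁ h₂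
    _ = 2 ^ (s * (d + 1) + 1) := by rw [pow_succ, mul_two]
    _ < 2 ^ (s * (d + 1) + 2) := Nat.pow_lt_pow_right (by norm_num) (by omega)
    _ ≤ _ := Nat.pow_le_pow_right (by norm_num) (by
      have : ((c ^ 2 + 2) * (d + 1) + 2) * L = s * (d + 1) + 2 * L := by rw [hs]; ring
      omega)

/-- The message-passing algorithm. -/
noncomputable def spannerAlgorithm (c d k : ℕ) : Algorithm :=
  machine (fun x => (c * x.nEst) ^ d + c * x.nEst) initial fun x => program k (c * x.aEst)

/-- A constant factor inside of a power with exponent in `[0, 1]` may be taken out. -/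
theorem rpow_le_of_le {c M a : ℕ} (hM : M ≠ 0) (h : M ≤ c * (c * a)) {t : ℝ} (h0 : 0 ≤ t)
    (h1 : t ≤ 1) : (M : ℝ) ^ t ≤ (c : ℝ) ^ 2 * (a : ℝ) ^ t := by
  have hc : 1 ≤ c := by
    rcases Nat.eq_zero_or_pos c with rfl | hc
    · omega
    · exact hc
  have hc' : (1 : ℝ) ≤ (c : ℝ) ^ 2 := one_le_pow₀ (by exact_mod_cast hc)
  have h' : (M : ℝ) ≤ (c : ℝ) ^ 2 * a := by
    have : ((M : ℕ) : ℝ) ≤ ((c * (c * a) : ℕ) : ℝ) := by exact_mod_cast h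
    push_cast at this
    linarith
  calc (M : ℝ) ^ t ≤ ((c : ℝ) ^ 2 * a) ^ t := Real.rpow_le_rpow (by positivity) h' h0
    _ = ((c : ℝ) ^ 2) ^ t * (a : ℝ) ^ t := Real.mul_rpow (by positivity) (by positivity)
    _ ≤ ((c : ℝ) ^ 2) ^ (1 : ℝ) * (a : ℝ) ^ t := by
      refine mul_le_mul_of_nonneg_right ?_ (by positivity)
      exact Real.rpow_le_rpow_of_exponent_le hc' h1
    _ = _ := by rw [Real.rpow_one]

end Program

end Congest

theorem lemma2 (c d : ℕ) :
    ∃ C : ℕ, ∀ k : ℕ, Even k → 4 ≤ k →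
      ∃ P : Congest.Algorithm,
        ∀ (V : Type*) [Fintype V] [DecidableEq V] (N : Congest.Network V) (B : Finset V),
          N.graph.IsBipartiteWith (N.A : Set V) (B : Set V) →
          N.A ∪ B = Finset.univ →
          N.A.card ≤ B.card →
          (∀ v, N.ident v < Fintype.card V ^ d) →
          Fintype.card V ≤ c * N.nEst → N.nEst ≤ c * Fintype.card V →
          N.A.card ≤ c * N.aEst → N.aEst ≤ c * N.A.card →
          Congest.RespectsBandwidth N P (C * Nat.log 2 (Fintype.card V)) ∧
          ∃ (H : SimpleGraph V) (T : ℕ),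
            Congest.ConstructsWithin N P H T ∧
            Congest.IsSpanner N.graph H (2 * k - 1) ∧
            (H.edgeSet.ncard : ℝ) ≤
              C * (k * (N.A.card : ℝ) ^ (1 + 2 / (k : ℝ)) + (B.card : ℝ)) ∧
            (T : ℝ) ≤ C * (N.A.card : ℝ) ^ (1 - 2 / (k : ℝ)) := by
  refine ⟨135 * c ^ 2 + ((c ^ 2 + 2) * (d + 1) + 2) + 4, fun k hk hk4 =>
    ⟨Congest.spannerAlgorithm c d k, ?_⟩⟩
  intro V _ _ N B hGB hAB _ hid hn hn' ha ha'
  set m := c * N.nEst with hm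
  set M := c * N.aEst with hM
  have hmn : m ≤ c * (c * Fintype.card V) := Nat.mul_le_mul_left c hn'
  have hMa : M ≤ c * (c * N.A.card) := Nat.mul_le_mul_left c ha'
  have hbip : Congest.Bipartite N := by
    intro u v huv
    rcases hGB.mem_of_adj huv with ⟨hu, hv⟩ | ⟨hu, hv⟩
    · exact ⟨fun _ h => Set.disjoint_left.1 hGB.disjoint h hv, fun _ => hu⟩
    · exact ⟨fun h => absurd hu (Set.disjoint_left.1 hGB.disjoint h), fun h => absurd hv h⟩
  have hcapK : ∀ v, (fun x : Congest.LocalInput => (c * x.nEst) ^ d + c * x.nEst)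
      (N.localInput v) = m ^ d + m := fun v => rfl
  have hidK : ∀ v, N.ident v + 1 ≤ m ^ d + m := fun v =>
    (Nat.succ_le_of_lt ((hid v).trans_le (Nat.pow_le_pow_left hn d))).trans (Nat.le_add_right _ _)
  have hK₁ : M ≠ 0 → 1 ≤ m ^ d + m := by
    intro h0
    have hA : 0 < N.A.card := by
      rcases Nat.eq_zero_or_pos N.A.card with h | h
      · rw [h] at hMa; omega
      · exact h
    have := Finset.card_le_univ N.A
    omega
  obtain ⟨τ, hx, hag, hstretch, hcount⟩ := Congest.exec_program (K := m ^ d + m) hk hk4 hbip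
    ha hK₁ (hn.trans (Nat.le_add_left _ _)) hidK
  refine ⟨?_, Congest.chosen N τ, (Congest.program k M).length, ?_, ?_, ?_, ?_⟩
  · intro t u v huv
    have h₁ := Congest.sent_machine_le (N := N) (cap := fun x => (c * x.nEst) ^ d + c * x.nEst)
      (init := Congest.initial)
      (prog := fun x => Congest.program k (c * x.aEst)) hcapK t u v
    have h2 : 2 ≤ Fintype.card V := Fintype.one_lt_card_iff.2 ⟨u, v, huv.ne⟩
    exact ((Nat.size_le_size h₁).trans (Congest.size_cap_le h2 hmn)).trans
      (Nat.mul_le_mul_right _ (by omega))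
  · intro v
    have h := Congest.run_machine (cap := fun x => (c * x.nEst) ^ d + c * x.nEst)
      (init := Congest.initial)
      (prog := fun x => Congest.program k (c * x.aEst)) hcapK (fun _ => rfl) hx v
    refine ⟨(τ v).sel, ?_, fun u hu => ?_⟩
    · rw [Congest.spannerAlgorithm, h]
      rfl
    · rw [Congest.chosen_adj hag]
      exact ⟨fun h => ⟨hu, h⟩, fun h => h.2⟩
  · refine Congest.isSpanner_of_within (by omega) (fun _ _ h => h.1) fun u v huv => ?_
    by_cases hu : u ∈ N.A
    · exact hstretch u v hu huv
    · exact (hstretch v u ((hbip v u huv.symm).2 hu) huv.symm).symm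
  · have hB : (Finset.univ.filter fun v => v ∉ N.A).card ≤ B.card := by
      refine Finset.card_le_card fun v hv => ?_
      have h₁ : v ∈ N.A ∪ B := by rw [hAB]; exact Finset.mem_univ v
      exact (Finset.mem_union.1 h₁).resolve_left (Finset.mem_filter.1 hv).2
    have hedges : ((Congest.chosen N τ).edgeSet.ncard : ℝ) ≤
        4 * B.card + (k / 2 : ℝ) * (4 * (N.A.card * (Congest.growth k M + 1))) := by
      have h₁ : (Congest.chosen N τ).edgeSet.ncard ≤
          4 * B.card + k / 2 * (4 * (N.A.card * (Congest.growth k M + 1))) := by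
        refine (Congest.ncard_edgeSet_chosen_le τ).trans (hcount.trans ?_)
        refine Nat.add_le_add_right (Nat.mul_le_mul_left 4 ?_) _
        convert hB
      have h₂ : ((k / 2 : ℕ) : ℝ) ≤ (k / 2 : ℝ) := Nat.cast_div_le
      calc ((Congest.chosen N τ).edgeSet.ncard : ℝ) ≤
          ((4 * B.card + k / 2 * (4 * (N.A.card * (Congest.growth k M + 1))) : ℕ) : ℝ) := by
            exact_mod_cast h₁
        _ = 4 * B.card + ((k / 2 : ℕ) : ℝ) * (4 * (N.A.card * (Congest.growth k M + 1))) := by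
            push_cast; rfl
        _ ≤ _ := by gcongr
    refine hedges.trans ?_
    rcases Nat.eq_zero_or_pos N.A.card with hA | hA
    · rw [hA]
      push_cast
      have : (0 : ℝ) ≤ k * (0 : ℝ) ^ (1 + 2 / (k : ℝ)) := by positivity
      have hB0 : (0 : ℝ) ≤ B.card := by positivity
      nlinarith [sq_nonneg (c : ℝ), mul_nonneg (sq_nonneg (c : ℝ)) hB0,
        (by positivity : (0 : ℝ) ≤ (135 * c ^ 2 + ((c ^ 2 + 2) * (d + 1) + 2)) *
          (k * (0 : ℝ) ^ (1 + 2 / (k : ℝ)) + B.card))]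
    · have hM0 : M ≠ 0 := by omega
      have hk' : (4 : ℝ) ≤ k := by exact_mod_cast hk4
      have hexp : 2 / (k : ℝ) ≤ 1 := by
        rw [div_le_one (by linarith)]
        linarith
      set a : ℝ := (N.A.card : ℝ) with ha_def
      have ha0 : (0 : ℝ) < a := Nat.cast_pos.2 hA
      have h₁ := Congest.growth_le (k := k) hM0
      have h₂ := Congest.rpow_le_of_le hM0 hMa (t := 2 / (k : ℝ)) (by positivity) hexp
      have h₃ : (1 : ℝ) ≤ (M : ℝ) ^ (2 / (k : ℝ)) :=
        Real.one_le_rpow (by exact_mod_cast Nat.one_le_iff_ne_zero.2 hM0) (by positivity)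
      have h₄ : a ^ (1 + 2 / (k : ℝ)) = a * a ^ (2 / (k : ℝ)) := by
        rw [Real.rpow_add ha0, Real.rpow_one]
      have h₅ : (Congest.growth k M : ℝ) + 1 ≤ 3 * ((c : ℝ) ^ 2 * a ^ (2 / (k : ℝ))) := by
        linarith
      have h₆ : (k / 2 : ℝ) * (4 * (a * (Congest.growth k M + 1))) ≤
          (k / 2 : ℝ) * (4 * (a * (3 * ((c : ℝ) ^ 2 * a ^ (2 / (k : ℝ)))))) := by gcongr
      set E : ℝ := k * a ^ (1 + 2 / (k : ℝ)) with hE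
      have hE0 : 0 ≤ E := by positivity
      have h₇ : (k / 2 : ℝ) * (4 * (a * (3 * ((c : ℝ) ^ 2 * a ^ (2 / (k : ℝ)))))) =
          6 * (c : ℝ) ^ 2 * E := by
        rw [hE, h₄]; ring
      have hB0 : (0 : ℝ) ≤ B.card := by positivity
      have h₈ : 0 ≤ (129 * (c : ℝ) ^ 2 + ((c ^ 2 + 2) * (d + 1) + 2) + 4) * E := by positivity
      have h₉ : 0 ≤ (135 * (c : ℝ) ^ 2 + ((c ^ 2 + 2) * (d + 1) + 2)) * (B.card : ℝ) := by
        positivity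
      push_cast
      linarith
  · rcases Nat.eq_zero_or_pos M with h0 | h0
    · rw [h0, Congest.program, if_pos rfl]
      simp only [List.length_nil, Nat.cast_zero]
      positivity
    · have hk' : (4 : ℝ) ≤ k := by exact_mod_cast hk4
      have hexp : 2 / (k : ℝ) ≤ 1 := by
        rw [div_le_one (by linarith)]
        linarith
      have hexp0 : 0 ≤ 2 / (k : ℝ) := by positivity
      have h₁ := Congest.length_program_le (M := M) hk4
      have h₂ := Congest.rpow_le_of_le h0.ne' hMa (t := 1 - 2 / (k : ℝ)) (by linarith) (by linarith)
      have h₃ : 0 ≤ (((c : ℝ) ^ 2 + 2) * (d + 1) + 2 + 4) *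
        (N.A.card : ℝ) ^ (1 - 2 / (k : ℝ)) := by positivity
      push_cast
      linarith
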